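/- **Conventions.** Rings are commutative with $1$; the trivial ring is allowed. A ring $\mathbf R$ is a *pp-ring* if the annihilator of every element is generated by an idempotent. $\operatorname{Frac}\mathbf R$ is the total ring of fractions of $\mathbf R$ (all non-zero-divisors are inverted), and $\mathrm{Kdim}$ of a ring is its Krull dimension ($-1$ for the trivial ring). *Dimension of a lattice.* For a bounded distributive lattice $\mathbf T$, $\mathrm{Kdim}\,\mathbf T\le -1$ means that $\mathbf T$ is reduced to a point, and for $n\ge 0$, $\mathrm{Kdim}\,\mathbf T\le n$ means that for all $x_0,\dots,x_n\in\mathbf T$ there are $y_0,\dots,y_n\in\mathbf T$ with $$1\le y_n\vee x_n,\qquad y_{i+1}\wedge x_{i+1}\le y_i\vee x_i\ \ (0\le i<n),\qquad y_0\wedge x_0\le 0 .$$ *Valuative lattice.* Let $\mathbf K$ be an $\mathbf R$-algebra. The dynamical theory $\mathcal{V}al(\mathbf K,\mathbf R)$ has the language of commutative rings with one constant for each element of $\mathbf K$ and two unary predicates $\cdot=0$ and $\mathrm{Vr}(\cdot)$. Terms are taken up to the identities of commutative rings, $x=y$ stands for $x-y=0$, and the axioms are: - (nontrivial discrete field) $\vdash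 0=0$; $\;x=0,\,y=0\vdash x+y=0$; $\;1=0\vdash\bot$; $\;x=0\vdash xy=0$; $\;\vdash x=0\text{ or }\exists y\ xy=1$; - (diagram of $\mathbf K$) $\vdash 0_{\mathbf K}=0$; $\;\vdash 1_{\mathbf K}=1$; $\;\vdash a+b=c$ if $a+b=c$ in $\mathbf K$; $\;\vdash ab=c$ if $ab=c$ in $\mathbf K$; - (valuation ring containing $\mathbf R$) $x=y,\,\mathrm{Vr}(x)\vdash\mathrm{Vr}(y)$; $\;\vdash\mathrm{Vr}(a)$ if $a$ is the image in $\mathbf K$ of an element of $\mathbf R$; $\;\mathrm{Vr}(x),\mathrm{Vr}(y)\vdash\mathrm{Vr}(xy)$; $\;\mathrm{Vr}(x),\mathrm{Vr}(y)\vdash\mathrm{Vr}(x+y)$; $\;xy=1\vdash\mathrm{Vr}(x)\text{ or }\mathrm{Vr}(y)$. $\mathrm{Val}(\mathbf K,\mathbf R)$ is the bounded distributive lattice generated by the elements of the unit group $\mathbf K^\times$ subject to the relations $x_1\wedge\dots\wedge x_k\le y_1\vee\dots\vee y_m$ whenever the theory $\mathcal{V}al(\mathbf K,\mathbf R)$ proves,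 by a finite dynamical proof tree (branching at "or", introducing fresh constants at "$\exists$"), the rule $$\mathrm{Vr}(x_1),\dots,\mathrm{Vr}(x_k)\vdash \mathrm{Vr}(y_1)\text{ or }\dots\text{ or }\mathrm{Vr}(y_m).$$ *The two valuative dimensions of a pp-ring.* For $n\ge 0$, $\mathrm{vdim}\,\mathbf R\le n$ means that $\mathrm{Kdim}\,\mathbf R[x_1,\dots,x_m]\le n$ for every finite sequence $x_1,\dots,x_m$ in $\operatorname{Frac}\mathbf R$, and $\mathrm{vdim}\,\mathbf R\le -1$ means that $\mathbf R$ is trivial. For $n\ge -1$, $\mathrm{Vdim}\,\mathbf R\le n$ means $\mathrm{Kdim}\,\mathrm{Val}(\operatorname{Frac}\mathbf R,\mathbf R)\le n$. **Lemma 3.5.** Let $\mathbf R$ be a pp-ring. Then $\operatorname{Frac}\mathbf R$ is reduced and zero-dimensional (of Krull dimension $\le 0$), and $\mathrm{vdim}\,\mathbf R=\mathrm{Vdim}\,\mathbf R$, that is, for every integer $n\ge -1$, $$\mathrm{vdim}\,\mathbf R\le n\iff \mathrm{Vdim}\,\mathbf R\le n .$$ -/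

import Mathlib

namespace ValuativeDim

universe u v

section Lattices

/-- Formal expressions of the language of bounded lattices over a set `S` of generators. -/
inductive LatTerm (S : Type u) : Type u
  | gen (s : S) : LatTerm S
  | top : LatTerm S
  | bot : LatTerm S
  | inf (a b : LatTerm S) : LatTerm S
  | sup (a b : LatTerm S) : LatTerm S

/-- The formal meet of a finite list of generators. -/
def LatTerm.meet {S : Type u} : List S → LatTerm S
  | [] => LatTerm.top
  | s :: l => LatTerm.inf (LatTerm.gen s) (LatTerm.meet l)

/-- The formal join of a finite list of generators. -/
def LatTerm.join {S : Type u} : List S → LatTerm S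
  | [] => LatTerm.bot
  | s :: l => LatTerm.sup (LatTerm.gen s) (LatTerm.join l)

/-- The inequalities between lattice expressions that follow from the laws of bounded distributive
lattices and from the relations `⋀ X ≤ ⋁ Y` for all finite `X`, `Y` with `E X Y`. -/
inductive LatTerm.Le {S : Type u} (E : List S → List S → Prop) : LatTerm S → LatTerm S → Prop
  | refl (a : LatTerm S) : LatTerm.Le E a a
  | trans {a b c : LatTerm S} : LatTerm.Le E a b → LatTerm.Le E b c → LatTerm.Le E a c
  | le_top (a : LatTerm S) : LatTerm.Le E a LatTerm.top
  | bot_le (a : LatTerm S) : LatTerm.Le E LatTerm.bot a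
  | inf_le_left (a b : LatTerm S) : LatTerm.Le E (LatTerm.inf a b) a
  | inf_le_right (a b : LatTerm S) : LatTerm.Le E (LatTerm.inf a b) b
  | le_inf {a b c : LatTerm S} :
      LatTerm.Le E a b → LatTerm.Le E a c → LatTerm.Le E a (LatTerm.inf b c)
  | le_sup_left (a b : LatTerm S) : LatTerm.Le E a (LatTerm.sup a b)
  | le_sup_right (a b : LatTerm S) : LatTerm.Le E b (LatTerm.sup a b)
  | sup_le {a b c : LatTerm S} :
      LatTerm.Le E a c → LatTerm.Le E b c → LatTerm.Le E (LatTerm.sup a b) c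
  | distrib (a b c : LatTerm S) :
      LatTerm.Le E (LatTerm.inf a (LatTerm.sup b c))
        (LatTerm.sup (LatTerm.inf a b) (LatTerm.inf a c))
  | entail {X Y : List S} : E X Y → LatTerm.Le E (LatTerm.meet X) (LatTerm.join Y)

/-- Two lattice expressions are identified when each is below the other. -/
def latSetoid {S : Type u} (E : List S → List S → Prop) : Setoid (LatTerm S) where
  r a b := LatTerm.Le E a b ∧ LatTerm.Le E b a
  iseqv :=
    { refl := fun a => ⟨.refl a, .refl a⟩
      symm := fun h => ⟨h.2, h.1⟩
      trans := fun h k => ⟨h.1.trans k.1, k.2.trans h.2⟩ }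

/-- The bounded distributive lattice defined by generators and relations: the generators are the
elements of `S`, the relations are `⋀ X ≤ ⋁ Y` for all finite `X`, `Y` with `E X Y`. -/
def GenLattice {S : Type u} (E : List S → List S → Prop) : Type u :=
  Quotient (latSetoid E)

namespace GenLattice

variable {S : Type u} {E : List S → List S → Prop}

instance : LE (GenLattice E) where
  le := Quotient.lift₂ (LatTerm.Le E) (fun _ _ _ _ h k =>
    propext ⟨fun l => h.2.trans (l.trans k.1), fun l => h.1.trans (l.trans k.2)⟩)

instance : Max (GenLattice E) where
  max := Quotient.map₂ LatTerm.sup (fun _ _ h _ _ k =>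
    ⟨.sup_le (h.1.trans (.le_sup_left _ _)) (k.1.trans (.le_sup_right _ _)),
      .sup_le (h.2.trans (.le_sup_left _ _)) (k.2.trans (.le_sup_right _ _))⟩)

instance : Min (GenLattice E) where
  min := Quotient.map₂ LatTerm.inf (fun _ _ h _ _ k =>
    ⟨.le_inf ((LatTerm.Le.inf_le_left _ _).trans h.1) ((LatTerm.Le.inf_le_right _ _).trans k.1),
      .le_inf ((LatTerm.Le.inf_le_left _ _).trans h.2) ((LatTerm.Le.inf_le_right _ _).trans k.2)⟩)

instance : Lattice (GenLattice E) where
  le_refl a := Quotient.inductionOn a LatTerm.Le.refl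
  le_trans a b c := Quotient.inductionOn₃ a b c (fun _ _ _ => LatTerm.Le.trans)
  le_antisymm a b := Quotient.inductionOn₂ a b (fun _ _ h k => Quotient.sound ⟨h, k⟩)
  sup := max
  inf := min
  le_sup_left a b := Quotient.inductionOn₂ a b LatTerm.Le.le_sup_left
  le_sup_right a b := Quotient.inductionOn₂ a b LatTerm.Le.le_sup_right
  sup_le a b c := Quotient.inductionOn₃ a b c (fun _ _ _ => LatTerm.Le.sup_le)
  inf_le_left a b := Quotient.inductionOn₂ a b LatTerm.Le.inf_le_left
  inf_le_right a b := Quotient.inductionOn₂ a b LatTerm.Le.inf_le_right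
  le_inf a b c := Quotient.inductionOn₃ a b c (fun _ _ _ => LatTerm.Le.le_inf)

instance : DistribLattice (GenLattice E) :=
  DistribLattice.ofInfSupLe
    (fun a b c => Quotient.inductionOn₃ a b c LatTerm.Le.distrib)

instance : BoundedOrder (GenLattice E) where
  top := Quotient.mk (latSetoid E) LatTerm.top
  bot := Quotient.mk (latSetoid E) LatTerm.bot
  le_top a := Quotient.inductionOn a LatTerm.Le.le_top
  bot_le a := Quotient.inductionOn a LatTerm.Le.bot_le

end GenLattice

/-- The sequence `y` is complementary to the sequence `x` in a bounded distributive lattice: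
`1 ≤ yₙ ∨ xₙ`, `yᵢ₊₁ ∧ xᵢ₊₁ ≤ yᵢ ∨ xᵢ` for `i < n`, and `y₀ ∧ x₀ ≤ 0`. -/
def IsComplementary {T : Type u} [DistribLattice T] [BoundedOrder T] {n : ℕ}
    (x y : Fin (n + 1) → T) : Prop :=
  ⊤ ≤ y (Fin.last n) ⊔ x (Fin.last n) ∧
    (∀ i : Fin n, y i.succ ⊓ x i.succ ≤ y i.castSucc ⊔ x i.castSucc) ∧
    y 0 ⊓ x 0 ≤ ⊥

/-- `Kdim T ≤ n` for a bounded distributive lattice `T`; the value `⊥` of `n` stands for `-1`. -/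
def KdimLE (T : Type u) [DistribLattice T] [BoundedOrder T] : WithBot ℕ → Prop
  | ⊥ => Subsingleton T
  | (n : ℕ) => ∀ x : Fin (n + 1) → T, ∃ y : Fin (n + 1) → T, IsComplementary x y

end Lattices

section Valuative

/-- Terms of the language of commutative rings, up to the identities of commutative rings, that are
built from one constant for each element of `K` and from `m` further constants (the witnesses which
have been introduced in a dynamical proof). -/
abbrev Trm (K : Type v) (m : ℕ) : Type v := MvPolynomial (K ⊕ Fin m) ℤ

/-- The constant attached to an element of `K`. -/
noncomputable def cst {K : Type v} {m : ℕ} (a : K) : Trm K m := MvPolynomial.X (Sum.inl a)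

/-- The most recently introduced witness. -/
noncomputable def newWit {K : Type v} {m : ℕ} : Trm K (m + 1) :=
  MvPolynomial.X (Sum.inr (Fin.last m))

/-- A term, seen as a term over one more witness. -/
noncomputable def liftTrm {K : Type v} {m : ℕ} (t : Trm K m) : Trm K (m + 1) :=
  MvPolynomial.rename (Sum.map id Fin.castSucc) t

/-- The closed atomic formulas `t = 0` and `Vr(t)`. -/
inductive Atm (K : Type v) (m : ℕ) : Type v
  | isZero (t : Trm K m) : Atm K m
  | vr (t : Trm K m) : Atm K m

/-- The closed atomic formula `t = t'`, that is, `t - t' = 0`. -/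
noncomputable def Atm.eq {K : Type v} {m : ℕ} (t t' : Trm K m) : Atm K m := Atm.isZero (t - t')

/-- A closed atomic formula, seen as a formula over one more witness. -/
noncomputable def Atm.lift {K : Type v} {m : ℕ} : Atm K m → Atm K (m + 1)
  | .isZero t => .isZero (liftTrm t)
  | .vr t => .vr (liftTrm t)

/-- A disjunct in the conclusion of a dynamical rule: an atomic formula `A`, or `∃ y, A(y)`, where
the bound variable `y` is represented by the new witness. -/
inductive Disj (K : Type v) (m : ℕ) : Type v
  | fact (A : Atm K m) : Disj K m
  | ex (A : Atm K (m + 1)) : Disj K m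

/-- The closed instances of the rules of the dynamical theory of valuation rings of the field `K`
with subring `R`. `ValRule R K m H C` means: from all formulas of `H`, infer the disjunction
of `C` (the empty disjunction is the collapse of the theory). -/
inductive ValRule (R : Type u) (K : Type v) [CommRing R] [CommRing K] [Algebra R K] (m : ℕ) :
    List (Atm K m) → List (Disj K m) → Prop
  -- nontrivial discrete fields
  | zero : ValRule R K m [] [.fact (.isZero 0)]
  | add (x y : Trm K m) : ValRule R K m [.isZero x, .isZero y] [.fact (.isZero (x + y))]
  | collapse : ValRule R K m [.isZero 1] []
  | mul (x y : Trm K m) : ValRule R K m [.isZero x] [.fact (.isZero (x * y))]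
  | field (x : Trm K m) :
      ValRule R K m [] [.fact (.isZero x), .ex (.eq (liftTrm x * newWit) 1)]
  -- the diagram of `K`
  | diagZero : ValRule R K m [] [.fact (.eq (cst 0) 0)]
  | diagOne : ValRule R K m [] [.fact (.eq (cst 1) 1)]
  | diagAdd (a b : K) : ValRule R K m [] [.fact (.eq (cst a + cst b) (cst (a + b)))]
  | diagMul (a b : K) : ValRule R K m [] [.fact (.eq (cst a * cst b) (cst (a * b)))]
  -- the predicate `Vr` is compatible with equality
  | vrCongr (x y : Trm K m) : ValRule R K m [.eq x y, .vr x] [.fact (.vr y)]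
  -- the predicate `Vr` describes a valuation ring which contains `R`
  | vrBase (r : R) : ValRule R K m [] [.fact (.vr (cst (algebraMap R K r)))]
  | vrMul (x y : Trm K m) : ValRule R K m [.vr x, .vr y] [.fact (.vr (x * y))]
  | vrAdd (x y : Trm K m) : ValRule R K m [.vr x, .vr y] [.fact (.vr (x + y))]
  | vrOr (x y : Trm K m) : ValRule R K m [.eq (x * y) 1] [.fact (.vr x), .fact (.vr y)]

/-- `DynProves R K m Γ Δ`: there is a dynamical proof (a finite tree) of the disjunction of `Δ` from
the facts `Γ`. A leaf is a node at which a formula of `Δ` is among the known facts. At any other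
node one applies a rule whose hypotheses are known facts, opens one branch for each disjunct of its
conclusion, and adds this disjunct to the facts known in that branch, with a fresh witness in the
case of an existential disjunct. -/
inductive DynProves (R : Type u) (K : Type v) [CommRing R] [CommRing K] [Algebra R K] :
    (m : ℕ) → List (Atm K m) → List (Atm K m) → Prop
  | leaf {m : ℕ} {Γ Δ : List (Atm K m)} (A : Atm K m) (hΓ : A ∈ Γ) (hΔ : A ∈ Δ) :
      DynProves R K m Γ Δ
  | step {m : ℕ} {Γ Δ : List (Atm K m)} (H : List (Atm K m)) (C : List (Disj K m))
      (hrule : ValRule R K m H C) (hH : ∀ A ∈ H, A ∈ Γ)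
      (hfact : ∀ A : Atm K m, Disj.fact A ∈ C → DynProves R K m (A :: Γ) Δ)
      (hex : ∀ A : Atm K (m + 1), Disj.ex A ∈ C →
        DynProves R K (m + 1) (A :: Γ.map Atm.lift) (Δ.map Atm.lift)) :
      DynProves R K m Γ Δ

/-- The entailment relation on `Kˣ`:
`Vr(x₁), …, Vr(xₙ) ⊢ Vr(y₁) or … or Vr(yₘ)` in the dynamical theory. -/
def valEntails (R : Type u) (K : Type v) [CommRing R] [CommRing K] [Algebra R K]
    (X Y : List Kˣ) : Prop :=
  DynProves R K 0 (X.map fun x => Atm.vr (cst (x : K))) (Y.map fun y => Atm.vr (cst (y : K)))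

/-- The valuative lattice `Val(K, R)`. -/
abbrev ValLattice (R : Type u) (K : Type v) [CommRing R] [CommRing K] [Algebra R K] : Type v :=
  GenLattice (valEntails R K)

/-- `Vdim R ≤ n`, that is, `Kdim (Val(Frac R, R)) ≤ n`. -/
def VdimLE (R : Type u) [CommRing R] (n : WithBot ℕ) : Prop :=
  KdimLE (ValLattice R (FractionRing R)) n

/-- `vdim R ≤ n` for a pp-ring `R`: `Kdim R[x₁, …, xₘ] ≤ n` for all finite sequences in the total
ring of fractions of `R`. The value `⊥` of `n` stands for `-1`. -/
def vdimLE (R : Type u) [CommRing R] : WithBot ℕ → Prop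
  | ⊥ => Subsingleton R
  | (n : ℕ) => ∀ (m : ℕ) (x : Fin m → FractionRing R),
      ringKrullDim (Algebra.adjoin R (Set.range x)) ≤ ((n : ℕ∞) : WithBot ℕ∞)

/-- A pp-ring: the annihilator of every element is generated by an idempotent. -/
def IsPPRing (R : Type u) [CommRing R] : Prop :=
  ∀ a : R, ∃ e : R, IsIdempotentElem e ∧ (Ideal.span {a}).annihilator = Ideal.span {e}

end Valuative

end ValuativeDim

/-! Write `K` for the total ring of fractions. Since `R` is a pp-ring, every element of `K` is a
unit times an idempotent (`IsUnitRegular`). Hence `K` is reduced, its primes are maximal, and every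
nonzero element of a residue field `K ⧸ Z` is the class of a unit of `K`.

For `n ≥ 0`, each dimension is `≤ n` exactly when no residue field `K ⧸ Z` carries a chain `W₀ > ⋯ >
Wₙ₊₁` of valuation rings containing the image of `R` (`HasValuationChain`).

Lattice side (`kdimLE_valLattice_iff`): the dimension is governed by chains of prime filters, and a
prime filter of `Val(K, R)` is a set of units of `K` that respects all provable rules. By soundness
and completeness of dynamical proofs these sets are the traces on `Kˣ` of valuation rings of residue
fields of `K`. An idempotent argument puts a whole chain over a single `Z`.

Ring side (`forall_ringKrullDim_le_iff`): given a chain of valuation rings, pick units in `Wᵢ` but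
not in `Wᵢ₊₁`; their inverses generate an algebra on which the centers of the `Wᵢ` strictly
increase. Conversely, a chain of primes of a subalgebra of `K` lies over a minimal prime, which is
contracted from some `Z`; repeated domination and composition of valuation rings realise the primes
as centers. -/

namespace ValuativeDim

universe u v

/-! ### Krull dimension of a distributive lattice through chains of prime filters. -/

section LatticeChains

variable {T : Type u} [DistribLattice T] [BoundedOrder T]

/-- The boundary ideal of `x` over `I`: it is generated by `x` and by all `y` with `y ⊓ x ∈ I`. -/
def boundaryIdeal (I : Order.Ideal T) (x : T) : Order.Ideal T where
  carrier := {z | ∃ y, y ⊓ x ∈ I ∧ z ≤ y ⊔ x}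
  lower' := fun _ _ hle ⟨y, hy, hz⟩ => ⟨y, hy, hle.trans hz⟩
  nonempty' := ⟨⊥, ⊥, by simp, bot_le⟩
  directed' := by
    rintro a ⟨y, hy, ha⟩ b ⟨z, hz, hb⟩
    refine ⟨y ⊔ z ⊔ x, ⟨y ⊔ z, ?_, le_rfl⟩, ?_, ?_⟩
    · rw [inf_sup_right]
      exact Order.Ideal.sup_mem hy hz
    · exact ha.trans (sup_le_sup_right le_sup_left x)
    · exact hb.trans (sup_le_sup_right le_sup_right x)

/-- A filter and an ideal which are disjoint are separated by a homomorphism to `Prop`. -/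
theorem exists_hom_of_disjoint (F : Order.PFilter T) (I : Order.Ideal T)
    (h : Disjoint (F : Set T) (I : Set T)) :
    ∃ φ : BoundedLatticeHom T Prop, (∀ f ∈ F, φ f) ∧ ∀ i ∈ I, ¬ φ i := by
  obtain ⟨J, hJ, hIJ, hFJ⟩ := DistribLattice.prime_ideal_of_disjoint_filter_ideal h
  have hproper := hJ.toIsProper
  refine ⟨{ toFun := fun t => t ∉ J, map_sup' := ?_, map_inf' := ?_, map_top' := ?_,
            map_bot' := ?_ }, ?_, ?_⟩
  · intro a b
    simp only [Order.Ideal.sup_mem_iff, sup_Prop_eq]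
    exact propext (by tauto)
  · intro a b
    have : a ⊓ b ∈ J ↔ a ∈ J ∨ b ∈ J :=
      ⟨hJ.mem_or_mem, fun h => h.elim (J.lower inf_le_left) (J.lower inf_le_right)⟩
    simp only [this, inf_Prop_eq]
    exact propext (by tauto)
  · exact eq_true (Order.Ideal.IsProper.top_notMem hproper)
  · simp
  · intro f hf hfJ
    exact Set.disjoint_left.1 hFJ hf hfJ
  · intro i hi h
    exact h (hIJ hi)

/-- The filter generated by `x` and by the elements where `φ` is true. -/
def adjoinFilter (φ : BoundedLatticeHom T Prop) (x : T) : Order.PFilter T :=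
  Order.IsPFilter.toPFilter (F := {z | ∃ f, φ f ∧ f ⊓ x ≤ z}) <| by
    refine Order.IsPFilter.of_def ⟨⊤, ⊤, by simp, le_top⟩ ?_ ?_
    · rintro a ⟨f, hf, ha⟩ b ⟨g, hg, hb⟩
      refine ⟨f ⊓ g ⊓ x, ⟨f ⊓ g, ?_, le_rfl⟩, ?_, ?_⟩
      · rw [map_inf]
        exact ⟨hf, hg⟩
      · exact (inf_le_inf_right x inf_le_left).trans ha
      · exact (inf_le_inf_right x inf_le_right).trans hb
    · rintro a b hab ⟨f, hf, ha⟩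
      exact ⟨f, hf, ha.trans hab⟩

/-- The filter generated by `φ` and `x` misses `I`: if `f ⊓ x ∈ I` with `φ f` true, then `f` would
lie in the boundary ideal, where `φ` is false. Prime separation then yields `ψ`. -/
theorem exists_hom_ge {I : Order.Ideal T} {x : T} {φ : BoundedLatticeHom T Prop}
    (h : ∀ z ∈ boundaryIdeal I x, ¬ φ z) :
    ∃ ψ : BoundedLatticeHom T Prop, (∀ t, φ t → ψ t) ∧ ¬ φ x ∧ ψ x ∧ ∀ z ∈ I, ¬ ψ z := by
  obtain ⟨ψ, hψ, hI⟩ := exists_hom_of_disjoint (adjoinFilter φ x) I <| by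
    refine Set.disjoint_left.2 ?_
    rintro z ⟨f, hf, hfz⟩ hz
    exact h f ⟨f, I.lower hfz hz, le_sup_left⟩ hf
  exact ⟨ψ, fun t ht => hψ t ⟨t, ht, inf_le_left⟩, h x ⟨⊥, by simp, le_sup_right⟩,
    hψ x ⟨⊤, by simp, inf_le_right⟩, hI⟩

/-- The iterated boundary ideals of a sequence. -/
def iterBoundary (x : ℕ → T) : ℕ → Order.Ideal T
  | 0 => ⊥
  | k + 1 => boundaryIdeal (iterBoundary x k) (x k)

theorem exists_chain_of_iterBoundary (x : ℕ → T) (k : ℕ) (φ : BoundedLatticeHom T Prop)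
    (h : ∀ z ∈ iterBoundary x k, ¬ φ z) :
    ∃ Φ : ℕ → BoundedLatticeHom T Prop, Φ k = φ ∧
      ∀ i < k, (∀ t, Φ (i + 1) t → Φ i t) ∧ ¬ Φ (i + 1) (x i) ∧ Φ i (x i) := by
  induction k generalizing φ with
  | zero => exact ⟨fun _ => φ, rfl, by simp⟩
  | succ k ih =>
    obtain ⟨ψ, h1, h2, h3, h4⟩ := exists_hom_ge h
    obtain ⟨Φ, rfl, hΦ⟩ := ih ψ h4
    refine ⟨Function.update Φ (k + 1) φ, by simp, fun i hi => ?_⟩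
    rw [Function.update_of_ne (show i ≠ k + 1 by omega)]
    rcases Nat.lt_succ_iff_lt_or_eq.1 hi with hi | rfl
    · rw [Function.update_of_ne (show i + 1 ≠ k + 1 by omega)]
      exact hΦ i hi
    · rw [Function.update_self]
      exact ⟨h1, h2, h3⟩

/-- Each layer of the iterated boundary ideal supplies one term of the complementary sequence; the
case `z = ⊤` is the one needed. -/
theorem exists_complementary_of_mem_iterBoundary (x : ℕ → T) (k : ℕ) (z : T)
    (h : z ∈ iterBoundary x (k + 1)) :
    ∃ y : ℕ → T, z ≤ y k ⊔ x k ∧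
      (∀ i < k, y (i + 1) ⊓ x (i + 1) ≤ y i ⊔ x i) ∧ y 0 ⊓ x 0 ≤ ⊥ := by
  induction k generalizing z with
  | zero =>
    obtain ⟨y, hy, hz⟩ := h
    exact ⟨fun _ => y, hz, by simp, Order.Ideal.mem_principal.1 hy⟩
  | succ k ih =>
    obtain ⟨w, hw, hz⟩ := h
    obtain ⟨y, h1, h2, h3⟩ := ih _ hw
    refine ⟨Function.update y (k + 1) w, by simpa using hz, fun i hi => ?_, ?_⟩
    · rw [Function.update_of_ne (show i ≠ k + 1 by omega)]
      rcases Nat.lt_succ_iff_lt_or_eq.1 hi with hi | rfl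
      · rw [Function.update_of_ne (show i + 1 ≠ k + 1 by omega)]
        exact h2 i hi
      · rw [Function.update_self]
        exact h1
    · rw [Function.update_of_ne (show 0 ≠ k + 1 by omega)]
      exact h3

theorem kdimLE_natCast (n : ℕ) : KdimLE T (n : WithBot ℕ) ↔
    ∀ x : Fin (n + 1) → T, ∃ y : Fin (n + 1) → T, IsComplementary x y := Iff.rfl

/-- The dimension of a bounded distributive lattice in terms of chains of prime filters, which are
seen as homomorphisms to `Prop`. -/
theorem kdimLE_iff (n : ℕ) :
    KdimLE T (n : WithBot ℕ) ↔ ¬ ∃ (Φ : ℕ → BoundedLatticeHom T Prop) (x : ℕ → T),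
      ∀ i ≤ n, (∀ t, Φ (i + 1) t → Φ i t) ∧ ¬ Φ (i + 1) (x i) ∧ Φ i (x i) := by
  rw [kdimLE_natCast]
  constructor
  · rintro h ⟨Φ, x, hΦ⟩
    obtain ⟨y, h1, h2, h3⟩ := h fun i : Fin (n + 1) => x i
    -- Along the chain the complementary inequalities force each `yₖ` to be false at `Φ (k + 1)`; at
    -- `k = n` this contradicts `⊤ ≤ yₙ ⊔ xₙ`.
    have key : ∀ k (hk : k ≤ n), ¬ Φ (k + 1) (y ⟨k, by omega⟩) := by
      intro k
      induction k with
      | zero =>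
        intro hk hy
        have : Φ 0 (y 0 ⊓ x 0) := by
          rw [map_inf]
          exact ⟨(hΦ 0 hk).1 _ hy, (hΦ 0 hk).2.2⟩
        have h' := OrderHomClass.mono (Φ 0) h3 this
        rw [map_bot] at h'
        exact h'
      | succ k ih =>
        intro hk hy
        have : Φ (k + 1) (y ⟨k + 1, by omega⟩ ⊓ x (k + 1)) := by
          rw [map_inf]
          exact ⟨(hΦ (k + 1) hk).1 _ hy, (hΦ (k + 1) hk).2.2⟩
        have h' := OrderHomClass.mono (Φ (k + 1)) (h2 ⟨k, by omega⟩) this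
        rw [map_sup] at h'
        exact h'.elim (ih (by omega)) (hΦ k (by omega)).2.1
    have h' := OrderHomClass.mono (Φ (n + 1)) h1 (by rw [map_top]; trivial)
    rw [map_sup] at h'
    exact h'.elim (key n le_rfl) (hΦ n le_rfl).2.1
  · intro h x
    -- Periodic extension to `ℕ`; only the values at indices `≤ n` matter.
    let x' : ℕ → T := fun i => x (Fin.ofNat (n + 1) i)
    have hx' : ∀ i (hi : i < n + 1), x' i = x ⟨i, hi⟩ := fun i hi =>
      congrArg x (Fin.ext (Nat.mod_eq_of_lt hi))
    by_cases htop : ⊤ ∈ iterBoundary x' (n + 1)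
    · obtain ⟨y, h1, h2, h3⟩ := exists_complementary_of_mem_iterBoundary x' n ⊤ htop
      refine ⟨fun i => y i, ?_, fun i => ?_, ?_⟩
      · rw [hx' n (by omega)] at h1
        exact h1
      · have := h2 i i.2
        rw [hx' _ (by omega), hx' i (by omega)] at this
        exact this
      · rw [hx' 0 (by omega)] at h3
        exact h3
    · obtain ⟨φ, -, hφ⟩ := exists_hom_of_disjoint (Order.PFilter.principal ⊤)
        (iterBoundary x' (n + 1)) <| by
          refine Set.disjoint_left.2 fun z hz hz' => htop ?_
          have : z = ⊤ := top_le_iff.1 hz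
          exact this ▸ hz'
      obtain ⟨Φ, -, hΦ⟩ := exists_chain_of_iterBoundary x' (n + 1) φ hφ
      exact absurd ⟨Φ, x', fun i hi => hΦ i (by omega)⟩ h

theorem subsingleton_iff_isEmpty_hom :
    Subsingleton T ↔ IsEmpty (BoundedLatticeHom T Prop) := by
  constructor
  · refine fun h => ⟨fun φ => ?_⟩
    have : φ ⊤ = φ ⊥ := congrArg φ (Subsingleton.elim _ _)
    rw [map_top, map_bot] at this
    exact this.mp trivial
  · intro h
    by_contra hT
    rw [not_subsingleton_iff_nontrivial] at hT
    obtain ⟨φ, -⟩ := exists_hom_of_disjoint (Order.PFilter.principal (⊤ : T)) ⊥ <| by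
      refine Set.disjoint_left.2 fun z hz hz' => top_ne_bot (α := T) ?_
      exact (top_le_iff.1 hz).symm.trans (le_bot_iff.1 hz')
    exact h.elim φ

end LatticeChains

/-! ### Prime filters of a lattice given by generators and relations. -/

section Points

variable {S : Type u} {E : List S → List S → Prop}

/-- A set `P` of generators is a point if it satisfies all the relations of `E`. -/
def IsPoint (E : List S → List S → Prop) (P : S → Prop) : Prop :=
  ∀ X Y, E X Y → (∀ x ∈ X, P x) → ∃ y ∈ Y, P y

/-- The truth value of a lattice expression. -/
def LatTerm.truth (P : S → Prop) : LatTerm S → Prop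
  | .gen s => P s
  | .top => True
  | .bot => False
  | .inf a b => a.truth P ∧ b.truth P
  | .sup a b => a.truth P ∨ b.truth P

theorem LatTerm.truth_meet (P : S → Prop) (X : List S) :
    (LatTerm.meet X).truth P ↔ ∀ x ∈ X, P x := by
  induction X with
  | nil => simp [LatTerm.meet, LatTerm.truth]
  | cons a l ih => simp [LatTerm.meet, LatTerm.truth, ih]

theorem LatTerm.truth_join (P : S → Prop) (X : List S) :
    (LatTerm.join X).truth P ↔ ∃ x ∈ X, P x := by
  induction X with
  | nil => simp [LatTerm.join, LatTerm.truth]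
  | cons a l ih => simp [LatTerm.join, LatTerm.truth, ih]

theorem LatTerm.Le.truth {P : S → Prop} (hP : IsPoint E P) {a b : LatTerm S}
    (h : LatTerm.Le E a b) : a.truth P → b.truth P := by
  induction h with
  | entail h =>
    rw [LatTerm.truth_meet, LatTerm.truth_join]
    exact hP _ _ h
  | refl => exact id
  | trans _ _ h k => exact k ∘ h
  | le_top => exact fun _ => trivial
  | bot_le => exact False.elim
  | inf_le_left => exact And.left
  | inf_le_right => exact And.right
  | le_inf _ _ h k => exact fun ha => ⟨h ha, k ha⟩
  | le_sup_left => exact Or.inl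
  | le_sup_right => exact Or.inr
  | sup_le _ _ h k => exact fun ha => ha.elim h k
  | distrib => exact and_or_left.1

/-- The homomorphism to `Prop` which belongs to a point. -/
def IsPoint.hom {P : S → Prop} (hP : IsPoint E P) : BoundedLatticeHom (GenLattice E) Prop where
  toFun := Quotient.lift (LatTerm.truth P) fun _ _ h => propext ⟨h.1.truth hP, h.2.truth hP⟩
  map_sup' a b := Quotient.inductionOn₂ a b fun _ _ => rfl
  map_inf' a b := Quotient.inductionOn₂ a b fun _ _ => rfl
  map_top' := rfl
  map_bot' := rfl

/-- The class of a lattice expression. -/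
def GenLattice.mk (E : List S → List S → Prop) (t : LatTerm S) : GenLattice E :=
  Quotient.mk (latSetoid E) t

/-- The image of a generator. -/
def GenLattice.of (E : List S → List S → Prop) (s : S) : GenLattice E :=
  GenLattice.mk E (LatTerm.gen s)

theorem hom_mk (φ : BoundedLatticeHom (GenLattice E) Prop) (t : LatTerm S) :
    φ (GenLattice.mk E t) = t.truth fun s => φ (GenLattice.of E s) := by
  induction t with
  | gen s => rfl
  | top => exact map_top φ
  | bot => exact map_bot φ
  | inf a b iha ihb =>
    rw [LatTerm.truth, ← iha, ← ihb]
    exact φ.map_inf' (GenLattice.mk E a) (GenLattice.mk E b)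
  | sup a b iha ihb =>
    rw [LatTerm.truth, ← iha, ← ihb]
    exact φ.map_sup' (GenLattice.mk E a) (GenLattice.mk E b)

theorem isPoint_of_hom (φ : BoundedLatticeHom (GenLattice E) Prop) :
    IsPoint E fun s => φ (GenLattice.of E s) := by
  intro X Y h hX
  rw [← LatTerm.truth_join (fun s => φ (GenLattice.of E s)), ← hom_mk]
  rw [← LatTerm.truth_meet (fun s => φ (GenLattice.of E s)), ← hom_mk] at hX
  have hle : GenLattice.mk E (LatTerm.meet X) ≤ GenLattice.mk E (LatTerm.join Y) := LatTerm.Le.entail h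
  exact OrderHomClass.mono φ hle hX

theorem LatTerm.truth_mono {P Q : S → Prop} (h : ∀ s, P s → Q s) (t : LatTerm S) :
    t.truth P → t.truth Q := by
  induction t with
  | gen s => exact h s
  | top => exact id
  | bot => exact id
  | inf a b iha ihb => exact And.imp iha ihb
  | sup a b iha ihb => exact Or.imp iha ihb

/-- Homomorphisms to `Prop` are determined by their values on generators. Lattice expressions are
monotone in these values, so two comparable homomorphisms that differ at some expression already
differ at a generator. -/
theorem genLattice_kdimLE_iff (n : ℕ) :
    KdimLE (GenLattice E) (n : WithBot ℕ) ↔ ¬ ∃ (P : ℕ → S → Prop) (x : ℕ → S),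
      (∀ i, IsPoint E (P i)) ∧
        ∀ i ≤ n, (∀ s, P (i + 1) s → P i s) ∧ ¬ P (i + 1) (x i) ∧ P i (x i) := by
  rw [kdimLE_iff, not_iff_not]
  constructor
  · rintro ⟨Φ, x, h⟩
    let P : ℕ → S → Prop := fun i s => Φ i (GenLattice.of E s)
    have hsep : ∀ i ≤ n, ∃ s, ¬ P (i + 1) s ∧ P i s := by
      intro i hi
      by_contra hs
      simp only [not_exists, not_and', not_not] at hs
      obtain ⟨-, h1, h2⟩ := h i hi
      revert h1 h2
      refine Quotient.inductionOn (x i) fun t => ?_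
      change ¬ Φ (i + 1) (GenLattice.mk E t) → Φ i (GenLattice.mk E t) → False
      rw [hom_mk, hom_mk]
      exact fun h1 h2 => h1 (LatTerm.truth_mono hs t h2)
    have hx : ∀ i, ∃ s, i ≤ n → ¬ P (i + 1) s ∧ P i s := by
      intro i
      by_cases hi : i ≤ n
      · obtain ⟨s, hs⟩ := hsep i hi
        -- An arbitrary generator as default value; strictness at index `0` shows that one exists.
        exact ⟨s, fun _ => hs⟩
      · obtain ⟨s, -⟩ := hsep 0 (by omega)
        exact ⟨s, fun h => absurd h hi⟩
    choose s hs using hx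
    exact ⟨P, s, fun i => isPoint_of_hom _, fun i hi => ⟨fun s => (h i hi).1 _, hs i hi⟩⟩
  · rintro ⟨P, x, hP, h⟩
    refine ⟨fun i => (hP i).hom, fun i => GenLattice.of E (x i), fun i hi => ⟨fun t => ?_, ?_⟩⟩
    · refine Quotient.inductionOn t fun t => ?_
      exact LatTerm.truth_mono (h i hi).1 t
    · exact (h i hi).2

theorem genLattice_subsingleton_iff :
    Subsingleton (GenLattice E) ↔ ¬ ∃ P : S → Prop, IsPoint E P := by
  rw [subsingleton_iff_isEmpty_hom, ← not_nonempty_iff, not_iff_not]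
  exact ⟨fun ⟨φ⟩ => ⟨_, isPoint_of_hom φ⟩, fun ⟨_, hP⟩ => ⟨hP.hom⟩⟩

end Points

/-! ### Renaming of witnesses and weakening in dynamical proofs. -/

section Renaming

variable {K : Type v} {m m' : ℕ}

/-- The action on terms of a map between the sets of witnesses. -/
noncomputable def renTrm (f : Fin m → Fin m') (t : Trm K m) : Trm K m' :=
  MvPolynomial.rename (Sum.map id f) t

/-- The action on atomic formulas of a map between the sets of witnesses. -/
noncomputable def Atm.ren (f : Fin m → Fin m') : Atm K m → Atm K m'
  | .isZero t => .isZero (renTrm f t)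
  | .vr t => .vr (renTrm f t)

theorem Atm.ren_isZero (f : Fin m → Fin m') (t : Trm K m) :
    (Atm.isZero t).ren f = .isZero (renTrm f t) := rfl

theorem Atm.ren_vr (f : Fin m → Fin m') (t : Trm K m) :
    (Atm.vr t).ren f = .vr (renTrm f t) := rfl

/-- The extension of a map between sets of witnesses which preserves the newest witness. -/
def extWit (f : Fin m → Fin m') : Fin (m + 1) → Fin (m' + 1) :=
  Fin.snoc (α := fun _ => Fin (m' + 1)) (fun i => (f i).castSucc) (Fin.last m')

/-- The action on disjuncts of a map between the sets of witnesses. -/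
noncomputable def Disj.ren (f : Fin m → Fin m') : Disj K m → Disj K m'
  | .fact A => .fact (A.ren f)
  | .ex A => .ex (A.ren (extWit f))

theorem renTrm_liftTrm (f : Fin m → Fin m') (t : Trm K m) :
    renTrm (extWit f) (liftTrm t) = liftTrm (renTrm f t) := by
  simp only [renTrm, liftTrm, MvPolynomial.rename_rename]
  congr 2
  ext (a | i) <;> simp [extWit]

theorem renTrm_newWit (f : Fin m → Fin m') :
    renTrm (extWit f) (newWit : Trm K (m + 1)) = newWit := by
  simp [renTrm, newWit, extWit]

theorem renTrm_cst (f : Fin m → Fin m') (a : K) : renTrm f (cst a) = cst a := by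
  simp [renTrm, cst]

theorem Atm.ren_lift (f : Fin m → Fin m') (A : Atm K m) :
    (A.lift).ren (extWit f) = (A.ren f).lift := by
  cases A <;> simp [Atm.lift, Atm.ren, renTrm_liftTrm]

theorem Atm.ren_eq (f : Fin m → Fin m') (s t : Trm K m) :
    (Atm.eq s t).ren f = Atm.eq (renTrm f s) (renTrm f t) := by
  simp [Atm.eq, Atm.ren, renTrm]

theorem Atm.lift_eq_ren (A : Atm K m) : A.lift = A.ren Fin.castSucc := by
  cases A <;> rfl

variable {R : Type u} [CommRing R] [CommRing K] [Algebra R K]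

theorem ValRule.ren (f : Fin m → Fin m') {H : List (Atm K m)} {C : List (Disj K m)}
    (h : ValRule R K m H C) : ValRule R K m' (H.map (Atm.ren f)) (C.map (Disj.ren f)) := by
  have hadd : ∀ s t : Trm K m, renTrm f (s + t) = renTrm f s + renTrm f t := fun s t => map_add _ s t
  have hmul : ∀ s t : Trm K m, renTrm f (s * t) = renTrm f s * renTrm f t := fun s t => map_mul _ s t
  have hzero : renTrm f (0 : Trm K m) = 0 := map_zero _
  have hone : renTrm f (1 : Trm K m) = 1 := map_one _
  have hmul' : ∀ s t : Trm K (m + 1), renTrm (extWit f) (s * t) =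
    renTrm (extWit f) s * renTrm (extWit f) t := fun s t => map_mul _ s t
  have hone' : renTrm (extWit f) (1 : Trm K (m + 1)) = 1 := map_one _
  cases h <;> simp only [List.map_cons, List.map_nil, Disj.ren, Atm.ren_eq, hadd, hmul, hzero, hone,
    hmul', hone', renTrm_liftTrm, renTrm_newWit, renTrm_cst, Atm.ren_isZero, Atm.ren_vr]
  case zero => exact .zero
  case add => exact .add _ _
  case collapse => exact .collapse
  case mul => exact .mul _ _
  case field => exact .field _
  case diagZero => exact .diagZero
  case diagOne => exact .diagOne
  case diagAdd => exact .diagAdd _ _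
  case diagMul => exact .diagMul _ _
  case vrCongr => exact .vrCongr _ _
  case vrBase => exact .vrBase _
  case vrMul => exact .vrMul _ _
  case vrAdd => exact .vrAdd _ _
  case vrOr => exact .vrOr _ _

/-- Needed to transport a proof into an existential branch, which has one more witness. -/
theorem DynProves.ren {Γ Δ : List (Atm K m)} (h : DynProves R K m Γ Δ) {m' : ℕ}
    (f : Fin m → Fin m') : DynProves R K m' (Γ.map (Atm.ren f)) (Δ.map (Atm.ren f)) := by
  induction h generalizing m' with
  | leaf A hΓ hΔ => exact .leaf _ (List.mem_map_of_mem hΓ) (List.mem_map_of_mem hΔ)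
  | step H C hrule hH _ _ ihf ihe =>
    refine .step _ _ (hrule.ren f) ?_ ?_ ?_
    · intro A hA
      obtain ⟨B, hB, rfl⟩ := List.mem_map.1 hA
      exact List.mem_map_of_mem (hH B hB)
    · intro A hA
      obtain ⟨B | B, hB, hBA⟩ := List.mem_map.1 hA
      · obtain rfl : B.ren f = A := by simpa [Disj.ren] using hBA
        exact ihf B hB f
      · simp [Disj.ren] at hBA
    · intro A hA
      obtain ⟨B | B, hB, hBA⟩ := List.mem_map.1 hA
      · simp [Disj.ren] at hBA
      · obtain rfl : B.ren (extWit f) = A := by simpa [Disj.ren] using hBA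
        have := ihe B hB (extWit f)
        simpa only [List.map_cons, List.map_map, Function.comp_def, Atm.ren_lift] using this

theorem DynProves.mono {Γ Δ : List (Atm K m)} (h : DynProves R K m Γ Δ) {Γ' Δ' : List (Atm K m)}
    (hΓ : Γ ⊆ Γ') (hΔ : Δ ⊆ Δ') : DynProves R K m Γ' Δ' := by
  induction h with
  | leaf A h k => exact .leaf A (hΓ h) (hΔ k)
  | step H C hrule hH _ _ ihf ihe =>
    exact .step H C hrule (fun A hA => hΓ (hH A hA))
      (fun A hA => ihf A hA (List.cons_subset_cons A hΓ) hΔ)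
      (fun A hA => ihe A hA (List.cons_subset_cons A (List.map_subset _ hΓ)) (List.map_subset _ hΔ))

end Renaming

/-! ### Adding derived facts, and products equal to zero. -/

section Cut

variable {R : Type u} {K : Type v} [CommRing R] [CommRing K] [Algebra R K] {m : ℕ}

variable (R) in
/-- The fact `A` may be added to the facts `Γ` in every dynamical proof. -/
def Admissible (Γ : List (Atm K m)) (A : Atm K m) : Prop :=
  ∀ Γ' Δ, Γ ⊆ Γ' → DynProves R K m (A :: Γ') Δ → DynProves R K m Γ' Δ

theorem Admissible.of_mem {Γ : List (Atm K m)} {A : Atm K m} (h : A ∈ Γ) : Admissible R Γ A :=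
  fun _ _ hΓ hp => hp.mono (List.cons_subset.2 ⟨hΓ h, List.Subset.refl _⟩) (List.Subset.refl _)

/-- The hypotheses of the rule are put in front of the known facts and removed one by one by
admissibility; with all of them present the rule itself yields `A`. -/
theorem Admissible.of_rule {Γ : List (Atm K m)} {H : List (Atm K m)} {A : Atm K m}
    (h : ValRule R K m H [.fact A]) (hH : ∀ B ∈ H, Admissible R Γ B) : Admissible R Γ A := by
  intro Γ' Δ hΓ hp
  have key : ∀ L : List (Atm K m), (∀ B ∈ L, Admissible R Γ B) → ∀ Γ'', Γ ⊆ Γ'' →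
      DynProves R K m (L ++ Γ'') Δ → DynProves R K m Γ'' Δ := by
    intro L
    induction L with
    | nil => exact fun _ _ _ h => h
    | cons B L ih =>
      intro hL Γ'' hΓ'' hB
      refine ih (fun B hB => hL B (List.mem_cons_of_mem _ hB)) Γ'' hΓ'' ?_
      exact hL B List.mem_cons_self _ _ (List.subset_append_of_subset_right _ hΓ'') hB
  refine key H hH Γ' hΓ (.step _ _ h (fun B hB => List.mem_append_left _ hB) ?_ ?_)
  · intro B hB
    obtain rfl : B = A := by simpa using hB
    exact hp.mono (List.cons_subset_cons _ (List.subset_append_right _ _)) (List.Subset.refl _)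
  · intro B hB
    simp at hB

variable (R) in
/-- The ideal of the terms which are provably zero. -/
noncomputable def admissibleIdeal (Γ : List (Atm K m)) : Ideal (Trm K m) where
  carrier := {t | Admissible R Γ (.isZero t)}
  zero_mem' := .of_rule .zero (by simp)
  add_mem' := fun {s t} hs ht => .of_rule (.add s t) (by simpa using ⟨hs, ht⟩)
  smul_mem' := fun s t ht => by
    have : Admissible R Γ (.isZero (t * s)) := .of_rule (.mul t s) (by simpa using ht)
    rwa [mul_comm] at this

/-- If the product of `a` and `c` is zero, then every field satisfies `a = 0` or `c = 0`. -/
theorem DynProves.of_mul_eq_zero {Γ Δ : List (Atm K m)} {a c : K} (hac : a * c = 0)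
    (ha : DynProves R K m (.isZero (cst a) :: Γ) Δ)
    (hc : DynProves R K m (.isZero (cst c) :: Γ) Δ) : DynProves R K m Γ Δ := by
  refine .step _ _ (.field (cst a)) (by simp) ?_ ?_
  · intro A hA
    obtain rfl : A = .isZero (cst a) := by simpa using hA
    exact ha
  · intro A hA
    have hlift : ∀ b : K, liftTrm (cst b : Trm K m) = cst b := fun b => renTrm_cst Fin.castSucc b
    obtain rfl : A = .eq (cst a * newWit) 1 := by simpa [hlift] using hA
    have hc' := hc.ren (m' := m + 1) Fin.castSucc
    simp only [List.map_cons, Atm.ren_isZero, renTrm_cst] at hc'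
    rw [← funext Atm.lift_eq_ren] at hc'
    set Γ' : List (Atm K (m + 1)) := .eq (cst a * newWit) 1 :: Γ.map Atm.lift
    have h1 : (cst a * newWit - 1 : Trm K (m + 1)) ∈ admissibleIdeal R Γ' :=
      .of_mem List.mem_cons_self
    have h2 : (cst a * cst c - cst (a * c) : Trm K (m + 1)) ∈ admissibleIdeal R Γ' :=
      .of_rule (.diagMul a c) (by simp)
    have h3 : (cst 0 - 0 : Trm K (m + 1)) ∈ admissibleIdeal R Γ' := .of_rule .diagZero (by simp)
    rw [hac] at h2
    have h4 : (cst c : Trm K (m + 1)) ∈ admissibleIdeal R Γ' := by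
      -- With `y` the inverse of `a` given by the field axiom, `c = (ac)y - (ay - 1)c`, and both
      -- terms are provably zero.
      have : (cst c : Trm K (m + 1)) = (cst a * cst c - cst 0) * newWit + (cst 0 - 0) * newWit
        - (cst a * newWit - 1) * cst c := by ring
      rw [this]
      exact Ideal.sub_mem _ (Ideal.add_mem _ (Ideal.mul_mem_right _ _ h2)
        (Ideal.mul_mem_right _ _ h3)) (Ideal.mul_mem_right _ _ h1)
    refine h4 Γ' _ (List.Subset.refl _) (hc'.mono ?_ (List.Subset.refl _))
    exact List.cons_subset_cons _ (List.subset_cons_self _ _)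

end Cut

/-! ### Soundness: valuation rings of fields over `K` give points. -/

section Soundness

variable {R : Type u} {K : Type v} [CommRing R] [CommRing K] [Algebra R K]
variable {L : Type v} [Field L]

/-- The value of a term. -/
noncomputable def evTrm (φ : K →+* L) {m : ℕ} (w : Fin m → L) : Trm K m →+* L :=
  (MvPolynomial.aeval (R := ℤ) (Sum.elim φ w)).toRingHom

theorem evTrm_cst (φ : K →+* L) {m : ℕ} (w : Fin m → L) (a : K) : evTrm φ w (cst a) = φ a := by
  simp [evTrm, cst]

theorem evTrm_snoc_newWit (φ : K →+* L) {m : ℕ} (w : Fin m → L) (y : L) :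
    evTrm φ (Fin.snoc (α := fun _ => L) w y) newWit = y := by
  simp [evTrm, newWit]

theorem evTrm_snoc_liftTrm (φ : K →+* L) {m : ℕ} (w : Fin m → L) (y : L) (t : Trm K m) :
    evTrm φ (Fin.snoc (α := fun _ => L) w y) (liftTrm t) = evTrm φ w t := by
  simp only [evTrm, liftTrm, AlgHom.toRingHom_eq_coe, RingHom.coe_coe, MvPolynomial.aeval_rename]
  congr 2
  ext (a | i) <;> simp

/-- The truth value of an atomic formula. -/
def Atm.holds (φ : K →+* L) (W : ValuationSubring L) {m : ℕ} (w : Fin m → L) : Atm K m → Prop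
  | .isZero t => evTrm φ w t = 0
  | .vr t => evTrm φ w t ∈ W

theorem Atm.holds_isZero (φ : K →+* L) (W : ValuationSubring L) {m : ℕ} (w : Fin m → L)
    (t : Trm K m) : (Atm.isZero t).holds φ W w ↔ evTrm φ w t = 0 := Iff.rfl

theorem Atm.holds_vr (φ : K →+* L) (W : ValuationSubring L) {m : ℕ} (w : Fin m → L)
    (t : Trm K m) : (Atm.vr t).holds φ W w ↔ evTrm φ w t ∈ W := Iff.rfl

theorem Atm.holds_lift (φ : K →+* L) (W : ValuationSubring L) {m : ℕ} (w : Fin m → L) (y : L)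
    (A : Atm K m) : A.lift.holds φ W (Fin.snoc (α := fun _ => L) w y) ↔ A.holds φ W w := by
  cases A <;> simp [Atm.lift, Atm.holds, evTrm_snoc_liftTrm]

theorem Atm.holds_eq (φ : K →+* L) (W : ValuationSubring L) {m : ℕ} (w : Fin m → L)
    (s t : Trm K m) : (Atm.eq s t).holds φ W w ↔ evTrm φ w s = evTrm φ w t := by
  simp [Atm.eq, Atm.holds, sub_eq_zero]

/-- The truth value of a disjunct. -/
def Disj.holds (φ : K →+* L) (W : ValuationSubring L) {m : ℕ} (w : Fin m → L) : Disj K m → Prop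
  | .fact A => A.holds φ W w
  | .ex A => ∃ y, A.holds φ W (Fin.snoc (α := fun _ => L) w y)

theorem ValRule.sound {φ : K →+* L} {W : ValuationSubring L}
    (hW : ∀ r : R, φ (algebraMap R K r) ∈ W) {m : ℕ} (w : Fin m → L) {H : List (Atm K m)}
    {C : List (Disj K m)} (h : ValRule R K m H C) (hH : ∀ A ∈ H, A.holds φ W w) :
    ∃ D ∈ C, D.holds φ W w := by
  cases h <;> simp only [List.mem_cons, List.not_mem_nil, or_false,
    exists_eq_left, exists_eq_or_imp, forall_eq_or_imp, forall_eq, Disj.holds, Atm.holds_eq,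
    Atm.holds_isZero, Atm.holds_vr, evTrm_cst, map_add, map_mul, map_zero, map_one, evTrm_snoc_newWit,
    evTrm_snoc_liftTrm, one_ne_zero] at hH ⊢
  case add => simp [hH.1, hH.2]
  case mul => simp [hH]
  case field x =>
    by_cases hx : evTrm φ w x = 0
    · exact .inl hx
    · exact .inr ⟨_, mul_inv_cancel₀ hx⟩
  case vrCongr => exact hH.1 ▸ hH.2
  case vrBase r => exact hW r
  case vrMul => exact W.mul_mem _ _ hH.1 hH.2
  case vrAdd => exact W.add_mem _ _ hH.1 hH.2
  case vrOr x y =>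
    rw [← inv_eq_of_mul_eq_one_right hH]
    exact W.mem_or_inv_mem _

theorem DynProves.sound {φ : K →+* L} {W : ValuationSubring L}
    (hW : ∀ r : R, φ (algebraMap R K r) ∈ W) {m : ℕ} (w : Fin m → L) {Γ Δ : List (Atm K m)}
    (h : DynProves R K m Γ Δ) (hΓ : ∀ A ∈ Γ, A.holds φ W w) : ∃ A ∈ Δ, A.holds φ W w := by
  induction h with
  | leaf A h k => exact ⟨A, k, hΓ A h⟩
  | step H C hrule hH _ _ ihf ihe =>
    obtain ⟨D | D, hD, hholds⟩ := hrule.sound hW w fun A hA => hΓ A (hH A hA)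
    · exact ihf D hD w (List.forall_mem_cons.2 ⟨hholds, hΓ⟩)
    · obtain ⟨y, hy⟩ := hholds
      obtain ⟨A, hA, hA'⟩ := ihe D hD (Fin.snoc (α := fun _ => L) w y) <|
        List.forall_mem_cons.2 ⟨hy, by simpa [Atm.holds_lift] using hΓ⟩
      obtain ⟨B, hB, rfl⟩ := List.mem_map.1 hA
      exact ⟨B, hB, (Atm.holds_lift φ W w y B).1 hA'⟩

theorem valEntails_iff {X Y : List Kˣ} : valEntails R K X Y ↔
    DynProves R K 0 (X.map fun x : Kˣ => Atm.vr (cst (x : K)))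
      (Y.map fun y : Kˣ => Atm.vr (cst (y : K))) := by
  have h : ∀ Z : List Kˣ, (Z >>= fun a => pure (a : K) : List K) = Z.map fun a : Kˣ => (a : K) :=
    fun Z => by induction Z <;> simp_all
  rw [valEntails, h, h, List.map_map, List.map_map]
  rfl

theorem isPoint_of_valuationSubring (φ : K →+* L) (W : ValuationSubring L)
    (hW : ∀ r : R, φ (algebraMap R K r) ∈ W) :
    IsPoint (valEntails R K) fun x : Kˣ => φ x ∈ W := by
  intro X Y h hX
  obtain ⟨A, hA, hA'⟩ := (valEntails_iff.1 h).sound hW Fin.elim0 <| by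
    simpa [Atm.holds, evTrm_cst] using hX
  obtain ⟨y, hy, rfl⟩ := List.mem_map.1 hA
  exact ⟨y, hy, by simpa [Atm.holds, evTrm_cst] using hA'⟩

end Soundness

/-! ### Rings in which every element is a unit times an idempotent. -/

section UnitRegular

/-- Every element is the product of a unit and an idempotent. -/
def IsUnitRegular (K : Type v) [CommRing K] : Prop :=
  ∀ a : K, ∃ (u : Kˣ) (f : K), IsIdempotentElem f ∧ a = u * f

variable {K : Type v} [CommRing K]

/-- Primality of `Z` is not assumed: deciding idempotents suffices, because an element outside `Z`
is associated to an idempotent `f` with `1 - f ∈ Z`. -/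
theorem IsUnitRegular.isMaximal (hK : IsUnitRegular K) {Z : Ideal K} (h1 : (1 : K) ∉ Z)
    (h : ∀ f : K, IsIdempotentElem f → f ∈ Z ∨ 1 - f ∈ Z) : Z.IsMaximal := by
  refine Ideal.isMaximal_iff.2 ⟨h1, fun J x hJ hx hxJ => ?_⟩
  obtain ⟨u, f, hf, rfl⟩ := hK x
  have hfZ : 1 - f ∈ Z := (h f hf).resolve_left fun hfZ => hx (Z.mul_mem_left _ hfZ)
  have hfJ : f ∈ J := by
    have := J.mul_mem_left (↑u⁻¹ : K) hxJ
    rwa [Units.inv_mul_cancel_left] at this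
  have := J.add_mem hfJ (hJ hfZ)
  rwa [add_sub_cancel] at this

theorem IsUnitRegular.isMaximal_of_isPrime (hK : IsUnitRegular K) {Z : Ideal K} (hZ : Z.IsPrime) :
    Z.IsMaximal := by
  refine hK.isMaximal ((Ideal.ne_top_iff_one Z).1 hZ.ne_top) fun f hf => hZ.mem_or_mem ?_
  rw [mul_sub, mul_one, hf.eq, sub_self]
  exact Z.zero_mem

theorem IsUnitRegular.krullDimLE_zero (hK : IsUnitRegular K) : Ring.KrullDimLE 0 K :=
  Ring.krullDimLE_zero_iff.2 fun _ hI => hK.isMaximal_of_isPrime hI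

theorem IsUnitRegular.isReduced (hK : IsUnitRegular K) : IsReduced K := by
  refine ⟨fun x ⟨n, hn⟩ => ?_⟩
  obtain ⟨u, f, hf, rfl⟩ := hK x
  rw [mul_pow] at hn
  have h : f ^ n = 0 := (Units.mul_right_eq_zero (u ^ n)).1 (by simpa using hn)
  rcases n with _ | n
  · have : Subsingleton K := subsingleton_of_zero_eq_one (by simpa using h.symm)
    exact Subsingleton.elim _ _
  · rw [hf.pow_succ_eq] at h
    rw [h, mul_zero]

/-- Every element outside of a prime ideal is congruent to a unit. -/
theorem IsUnitRegular.exists_unit (hK : IsUnitRegular K) {Z : Ideal K} (hZ : Z.IsPrime) {a : K}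
    (ha : a ∉ Z) : ∃ u : Kˣ, (u : K) - a ∈ Z := by
  obtain ⟨u, f, hf, rfl⟩ := hK a
  have hfZ : f ∉ Z := fun h => ha (Z.mul_mem_left _ h)
  have h1 : 1 - f ∈ Z := by
    refine (hZ.mem_or_mem (x := f) ?_).resolve_left hfZ
    rw [mul_sub, mul_one, hf.eq, sub_self]
    exact Z.zero_mem
  refine ⟨u, ?_⟩
  have := Z.mul_mem_left (u : K) h1
  rwa [mul_sub, mul_one] at this

end UnitRegular

/-! ### Completeness: every point comes from a valuation ring of a residue field. -/

section Saturation

variable {R : Type u} {K : Type v} [CommRing R] [CommRing K] [Algebra R K] {m : ℕ}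

variable (R) in
/-- No finite disjunction of formulas of `Δ` follows from finitely many facts of `G`. -/
def Consistent (Δ G : Set (Atm K m)) : Prop :=
  ∀ L D : List (Atm K m), (∀ A ∈ L, A ∈ G) → (∀ A ∈ D, A ∈ Δ) → ¬ DynProves R K m L D

variable (R) in
/-- `G` is a maximal set of facts from which no finite disjunction of formulas of `Δ` follows. -/
structure Saturated (Δ G : Set (Atm K m)) : Prop where
  consistent : Consistent R Δ G
  exists_proof : ∀ A ∉ G, ∃ L D : List (Atm K m), (∀ B ∈ L, B ∈ G) ∧ (∀ B ∈ D, B ∈ Δ) ∧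
    DynProves R K m (A :: L) D

theorem Consistent.exists_saturated {Δ G₀ : Set (Atm K m)} (h : Consistent R Δ G₀) :
    ∃ G, G₀ ⊆ G ∧ Saturated R Δ G := by
  classical
  -- A proof uses finitely many facts, so the union of a chain of consistent sets is consistent.
  obtain ⟨G, hG₀, hG⟩ := zorn_subset_nonempty {G | Consistent R Δ G} (by
    intro c hc hchain hne
    refine ⟨⋃₀ c, ?_, fun s hs => Set.subset_sUnion_of_mem hs⟩
    intro L D hL hD
    obtain ⟨t, ht, hLt⟩ := DirectedOn.exists_mem_subset_of_finite_of_subset_sUnion hne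
      hchain.directedOn (List.finite_toSet L) hL
    exact hc ht L D hLt hD) G₀ h
  refine ⟨G, hG₀, hG.prop, fun A hA => ?_⟩
  have hins : ¬ Consistent R Δ (insert A G) := fun hcon =>
    hA (hG.le_of_ge hcon (Set.subset_insert A G) (Set.mem_insert A G))
  simp only [Consistent, not_forall, not_not] at hins
  obtain ⟨L, D, hL, hD, hp⟩ := hins
  refine ⟨L.filter (· ∈ G), D, by simp, hD, hp.mono (fun B hB => ?_) (List.Subset.refl _)⟩
  rcases hL B hB with rfl | hB'
  · exact List.mem_cons_self
  · exact List.mem_cons_of_mem _ (List.mem_filter.2 ⟨hB, by simpa using hB'⟩)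

namespace Saturated

variable {Δ G : Set (Atm K m)} (hG : Saturated R Δ G)
include hG

theorem exists_common_proof (C : List (Atm K m)) (hC : ∀ A ∈ C, A ∉ G) :
    ∃ L D : List (Atm K m), (∀ B ∈ L, B ∈ G) ∧ (∀ B ∈ D, B ∈ Δ) ∧
      ∀ A ∈ C, DynProves R K m (A :: L) D := by
  induction C with
  | nil => exact ⟨[], [], by simp⟩
  | cons A C ih =>
    obtain ⟨L, D, hL, hD, h⟩ := ih fun B hB => hC B (List.mem_cons_of_mem _ hB)
    obtain ⟨L', D', hL', hD', h'⟩ := hG.exists_proof A (hC A List.mem_cons_self)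
    refine ⟨L ++ L', D ++ D', ?_, ?_, ?_⟩
    · simp only [List.mem_append]
      exact fun B hB => hB.elim (hL B) (hL' B)
    · simp only [List.mem_append]
      exact fun B hB => hB.elim (hD B) (hD' B)
    · rintro B hB
      rcases List.mem_cons.1 hB with rfl | hB
      · exact h'.mono (List.cons_subset_cons _ (List.subset_append_right _ _))
          (List.subset_append_right _ _)
      · exact (h B hB).mono (List.cons_subset_cons _ (List.subset_append_left _ _))
          (List.subset_append_left _ _)

/-- Only rules without existential disjuncts are covered, so no witnesses have to be added to `G`.
The field axiom enters solely through `DynProves.of_mul_eq_zero`, in `mem_zeroIdeal_or`. -/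
theorem exists_mem_of_rule {H C : List (Atm K m)} (h : ValRule R K m H (C.map Disj.fact))
    (hH : ∀ A ∈ H, A ∈ G) : ∃ A ∈ C, A ∈ G := by
  by_contra hC
  simp only [not_exists, not_and] at hC
  obtain ⟨L, D, hL, hD, hp⟩ := hG.exists_common_proof C hC
  refine hG.consistent (H ++ L) D ?_ hD (.step H _ h (fun A hA => List.mem_append_left _ hA) ?_ ?_)
  · simp only [List.mem_append]
    exact fun B hB => hB.elim (hH B) (hL B)
  · intro A hA
    have hA' : A ∈ C := by simpa using hA
    exact (hp A hA').mono (List.cons_subset_cons _ (List.subset_append_right _ _))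
      (List.Subset.refl _)
  · intro A hA
    simp at hA

theorem mem_of_rule {H : List (Atm K m)} {A : Atm K m} (h : ValRule R K m H [.fact A])
    (hH : ∀ A ∈ H, A ∈ G) : A ∈ G := by
  simpa using hG.exists_mem_of_rule (C := [A]) h hH

/-- The ideal of the terms which are zero in a saturated set of facts. -/
noncomputable def termIdeal : Ideal (Trm K m) where
  carrier := {t | .isZero t ∈ G}
  zero_mem' := hG.mem_of_rule .zero (by simp)
  add_mem' := fun {s t} hs ht => hG.mem_of_rule (.add s t) (by simpa using ⟨hs, ht⟩)
  smul_mem' := fun s t ht => by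
    have : .isZero (t * s) ∈ G := hG.mem_of_rule (.mul t s) (by simpa using ht)
    rwa [mul_comm] at this

theorem mk_eq_mk_iff {s t : Trm K m} :
    Ideal.Quotient.mk hG.termIdeal s = Ideal.Quotient.mk hG.termIdeal t ↔ .eq s t ∈ G :=
  Ideal.Quotient.eq

/-- The homomorphism from `K` to the ring of terms modulo provable equality. -/
noncomputable def cstHom : K →+* Trm K m ⧸ hG.termIdeal where
  toFun a := Ideal.Quotient.mk _ (cst a)
  map_one' := (hG.mk_eq_mk_iff (t := 1)).2 (hG.mem_of_rule .diagOne (by simp))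
  map_zero' := (hG.mk_eq_mk_iff (t := 0)).2 (hG.mem_of_rule .diagZero (by simp))
  map_add' a b := by
    rw [← map_add]
    exact (hG.mk_eq_mk_iff.2 (hG.mem_of_rule (.diagAdd a b) (by simp))).symm
  map_mul' a b := by
    rw [← map_mul]
    exact (hG.mk_eq_mk_iff.2 (hG.mem_of_rule (.diagMul a b) (by simp))).symm

theorem cstHom_apply (a : K) : hG.cstHom a = Ideal.Quotient.mk _ (cst a) := rfl

/-- The ideal of the elements of `K` which are zero in a saturated set of facts. -/
noncomputable def zeroIdeal : Ideal K := RingHom.ker hG.cstHom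

theorem mem_zeroIdeal {a : K} : a ∈ hG.zeroIdeal ↔ .isZero (cst a) ∈ G := by
  rw [zeroIdeal, RingHom.mem_ker, cstHom_apply, Ideal.Quotient.eq_zero_iff_mem]
  rfl

theorem one_notMem_zeroIdeal : (1 : K) ∉ hG.zeroIdeal := by
  rw [zeroIdeal, RingHom.mem_ker, map_one, ← map_one (Ideal.Quotient.mk _),
    Ideal.Quotient.eq_zero_iff_mem]
  intro h
  simpa using hG.exists_mem_of_rule (C := []) .collapse (List.forall_mem_singleton.2 h)

theorem mem_zeroIdeal_or {a c : K} (hac : a * c = 0) : a ∈ hG.zeroIdeal ∨ c ∈ hG.zeroIdeal := by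
  by_contra h
  rw [not_or, mem_zeroIdeal, mem_zeroIdeal] at h
  obtain ⟨L, D, hL, hD, hp⟩ := hG.exists_common_proof [.isZero (cst a), .isZero (cst c)]
    (by simpa using h)
  exact hG.consistent L D hL hD (.of_mul_eq_zero hac (hp _ (by simp)) (hp _ (by simp)))

theorem isMaximal_zeroIdeal (hK : IsUnitRegular K) : hG.zeroIdeal.IsMaximal :=
  hK.isMaximal hG.one_notMem_zeroIdeal fun f hf => hG.mem_zeroIdeal_or <| by
    rw [mul_sub, mul_one, hf.eq, sub_self]

theorem vr_congr {s t : Trm K m}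
    (h : Ideal.Quotient.mk hG.termIdeal s = Ideal.Quotient.mk hG.termIdeal t)
    (hs : .vr s ∈ G) : .vr t ∈ G :=
  hG.mem_of_rule (.vrCongr s t) (by simpa using ⟨hG.mk_eq_mk_iff.1 h, hs⟩)

theorem vr_algebraMap (r : R) : .vr (cst (algebraMap R K r)) ∈ G :=
  hG.mem_of_rule (.vrBase r) (by simp)

theorem vr_mul {a b : K} (ha : .vr (cst a) ∈ G) (hb : .vr (cst b) ∈ G) :
    .vr (cst (a * b)) ∈ G := by
  refine hG.vr_congr ?_ (hG.mem_of_rule (.vrMul (cst a) (cst b)) (by simpa using ⟨ha, hb⟩))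
  rw [map_mul, ← cstHom_apply, ← cstHom_apply, ← cstHom_apply, map_mul]

theorem vr_add {a b : K} (ha : .vr (cst a) ∈ G) (hb : .vr (cst b) ∈ G) :
    .vr (cst (a + b)) ∈ G := by
  refine hG.vr_congr ?_ (hG.mem_of_rule (.vrAdd (cst a) (cst b)) (by simpa using ⟨ha, hb⟩))
  rw [map_add, ← cstHom_apply, ← cstHom_apply, ← cstHom_apply, map_add]

theorem vr_or {a b : K} (h : a * b - 1 ∈ hG.zeroIdeal) : .vr (cst a) ∈ G ∨ .vr (cst b) ∈ G := by
  have h1 : .eq (cst a * cst b) 1 ∈ G := by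
    rw [← hG.mk_eq_mk_iff, map_mul, ← cstHom_apply, ← cstHom_apply, map_one, ← map_mul,
      ← sub_eq_zero, ← map_one hG.cstHom, ← map_sub]
    exact h
  simpa using hG.exists_mem_of_rule (C := [.vr (cst a), .vr (cst b)]) (.vrOr _ _)
    (by simpa using h1)

/-- The subring of the elements of `K` which satisfy `Vr` in a saturated set of facts. -/
noncomputable def vrSubring : Subring K where
  carrier := {a | Atm.vr (cst a) ∈ G}
  mul_mem' := hG.vr_mul
  one_mem' := by
    have := hG.vr_algebraMap 1
    rwa [map_one] at this
  add_mem' := hG.vr_add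
  zero_mem' := by
    have := hG.vr_algebraMap 0
    rwa [map_zero] at this
  neg_mem' := fun {a} ha => by
    have := hG.vr_mul (hG.vr_algebraMap (-1)) ha
    rwa [map_neg, map_one, neg_one_mul] at this

end Saturated

attribute [local instance] Ideal.Quotient.field

/-- Being a point means that the facts `Vr(x)` with `P x` prove no disjunction of `Vr(y)` with `¬ P
y`. In a saturated extension the constants provably zero form a maximal ideal `Z`, and those
satisfying `Vr` map onto a valuation ring of `K ⧸ Z`. -/
theorem exists_valuationSubring_of_isPoint (hK : IsUnitRegular K) {P : Kˣ → Prop}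
    (hP : IsPoint (valEntails R K) P) :
    ∃ (Z : Ideal K) (_ : Z.IsMaximal) (W : ValuationSubring (K ⧸ Z)),
      (∀ r : R, Ideal.Quotient.mk Z (algebraMap R K r) ∈ W) ∧
        ∀ x : Kˣ, P x ↔ Ideal.Quotient.mk Z (x : K) ∈ W := by
  let G₀ : Set (Atm K 0) := (fun x : Kˣ => Atm.vr (cst (x : K))) '' {x | P x}
  let Δ : Set (Atm K 0) := (fun x : Kˣ => Atm.vr (cst (x : K))) '' {x | ¬ P x}
  have hcon : Consistent R Δ G₀ := by
    intro L D hL hD hp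
    obtain ⟨X, hX, rfl⟩ : ∃ X : List Kˣ, (∀ x ∈ X, P x) ∧
        X.map (fun x : Kˣ => Atm.vr (cst (x : K))) = L := by
      clear hp
      induction L with
      | nil => exact ⟨[], by simp⟩
      | cons A L ih =>
        obtain ⟨X, hX, rfl⟩ := ih fun B hB => hL B (List.mem_cons_of_mem _ hB)
        obtain ⟨x, hx, rfl⟩ := hL A List.mem_cons_self
        exact ⟨x :: X, List.forall_mem_cons.2 ⟨hx, hX⟩, rfl⟩
    obtain ⟨Y, hY, rfl⟩ : ∃ Y : List Kˣ, (∀ x ∈ Y, ¬ P x) ∧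
        Y.map (fun x : Kˣ => Atm.vr (cst (x : K))) = D := by
      clear hp
      induction D with
      | nil => exact ⟨[], by simp⟩
      | cons A L ih =>
        obtain ⟨X, hX, rfl⟩ := ih fun B hB => hD B (List.mem_cons_of_mem _ hB)
        obtain ⟨x, hx, rfl⟩ := hD A List.mem_cons_self
        exact ⟨x :: X, List.forall_mem_cons.2 ⟨hx, hX⟩, rfl⟩
    obtain ⟨y, hy, hPy⟩ := hP X Y (valEntails_iff.2 hp) hX
    exact hY y hy hPy
  obtain ⟨G, hG₀, hG⟩ := hcon.exists_saturated
  have hmax := hG.isMaximal_zeroIdeal hK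
  let W : ValuationSubring (K ⧸ hG.zeroIdeal) :=
    { hG.vrSubring.map (Ideal.Quotient.mk hG.zeroIdeal) with
      mem_or_inv_mem' := by
        intro x
        by_cases hx : x = 0
        · rw [hx]
          exact .inl (Subring.zero_mem _)
        · obtain ⟨a, rfl⟩ := Ideal.Quotient.mk_surjective x
          obtain ⟨b, hb⟩ := Ideal.Quotient.mk_surjective (Ideal.Quotient.mk hG.zeroIdeal a)⁻¹
          have hab : a * b - 1 ∈ hG.zeroIdeal := by
            rw [← Ideal.Quotient.eq_zero_iff_mem, map_sub, map_mul, hb, mul_inv_cancel₀ hx,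
              map_one, sub_self]
          rw [← hb]
          exact (hG.vr_or hab).imp (fun h => ⟨a, h, rfl⟩) fun h => ⟨b, h, rfl⟩ }
  refine ⟨hG.zeroIdeal, hmax, W, fun r => ⟨_, hG.vr_algebraMap r, rfl⟩, fun x => ⟨fun hx => ?_, ?_⟩⟩
  · exact ⟨x, hG₀ ⟨x, hx, rfl⟩, rfl⟩
  · rintro ⟨a, ha, hax⟩
    have hx : .vr (cst (x : K)) ∈ G := by
      refine hG.vr_congr ?_ ha
      rw [← hG.cstHom_apply, ← hG.cstHom_apply, ← sub_eq_zero, ← map_sub]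
      exact Ideal.Quotient.eq.1 hax
    -- Otherwise `Vr(x)` lies both in `G` and among the forbidden conclusions, and a leaf
    -- contradicts consistency.
    by_contra hPx
    refine hG.consistent [.vr (cst (x : K))] [.vr (cst (x : K))] (by simpa using hx) ?_
      (.leaf (.vr (cst (x : K))) (by simp) (by simp))
    intro A hA
    exact ⟨x, hPx, (List.mem_singleton.1 hA).symm⟩

end Saturation

/-! ### Valuation rings with prescribed centers. -/

section Domination

variable {A : Type u} [CommRing A] {L : Type v} [Field L]

/-- Elements outside `p` become invertible in `L`, so `f` extends to the localization at `p`; a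
valuation ring dominating this local ring has center `p`. -/
theorem exists_valuationSubring_of_ker_le (f : A →+* L) (p : Ideal A) [p.IsPrime]
    (hp : RingHom.ker f ≤ p) :
    ∃ W : ValuationSubring L, (∀ a, f a ∈ W) ∧ ∀ a, a ∈ p ↔ f a ∈ W.nonunits := by
  have hunit : ∀ y : p.primeCompl, IsUnit (f y) := fun y =>
    isUnit_iff_ne_zero.2 fun h => y.2 (hp h)
  let g : Localization.AtPrime p →+* L := IsLocalization.lift hunit
  have hg : ∀ a, g (algebraMap A _ a) = f a := IsLocalization.lift_eq hunit
  obtain ⟨W, hW, hloc⟩ := IsLocalRing.exists_factor_valuationRing g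
  refine ⟨W, fun a => hg a ▸ hW _, fun a => ?_⟩
  rw [← IsLocalization.AtPrime.to_map_mem_maximal_iff (Localization.AtPrime p) p a,
    IsLocalRing.mem_maximalIdeal, mem_nonunits_iff, ← isUnit_map_iff (g.codRestrict W.toSubring hW),
    ← hg a]
  exact (ValuationSubring.coe_mem_nonunits_iff (A := W)
    (a := g.codRestrict W.toSubring hW (algebraMap A _ a))).symm

/-- The composite of a valuation subring with a valuation subring of its residue field. -/
def compositeValuation (V : ValuationSubring L)
    (W : ValuationSubring (IsLocalRing.ResidueField V)) : ValuationSubring L :=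
  { (W.toSubring.comap (IsLocalRing.residue V)).map V.toSubring.subtype with
    mem_or_inv_mem' := by
      intro x
      by_cases hx : x ∈ V
      -- For a unit of `V` the question passes to the residue field; a nonunit has residue `0`,
      -- which lies in `W`.
      · by_cases hu : IsUnit (⟨x, hx⟩ : V)
        · obtain ⟨y, hy⟩ := hu.exists_right_inv
          have hxy : x * y = 1 := congrArg Subtype.val hy
          have hres : IsLocalRing.residue V ⟨x, hx⟩ * IsLocalRing.residue V y = 1 := by
            rw [← map_mul, hy, map_one]
          rw [inv_eq_of_mul_eq_one_right hxy]
          refine (W.mem_or_inv_mem (IsLocalRing.residue V ⟨x, hx⟩)).imp (fun h => ⟨_, h, rfl⟩)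
            fun h => ⟨y, ?_, rfl⟩
          rwa [inv_eq_of_mul_eq_one_right hres] at h
        · refine .inl ⟨⟨x, hx⟩, ?_, rfl⟩
          have : IsLocalRing.residue V ⟨x, hx⟩ = 0 := (IsLocalRing.residue_eq_zero_iff _).2 hu
          change IsLocalRing.residue V ⟨x, hx⟩ ∈ W
          rw [this]
          exact W.zero_mem
      · have hx0 : x ≠ 0 := fun h => hx (h ▸ V.zero_mem)
        have hmem : x⁻¹ ∈ V.nonunits := V.inv_mem_nonunits_iff.2 (.inr hx)
        obtain ⟨hV, hmax⟩ := V.mem_nonunits_iff_exists_mem_maximalIdeal.1 hmem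
        refine .inr ⟨⟨x⁻¹, hV⟩, ?_, rfl⟩
        have : IsLocalRing.residue V ⟨x⁻¹, hV⟩ = 0 := (IsLocalRing.residue_eq_zero_iff _).2 hmax
        change IsLocalRing.residue V ⟨x⁻¹, hV⟩ ∈ W
        rw [this]
        exact W.zero_mem }

theorem mem_compositeValuation {V : ValuationSubring L}
    {W : ValuationSubring (IsLocalRing.ResidueField V)} {x : V} :
    (x : L) ∈ compositeValuation V W ↔ IsLocalRing.residue V x ∈ W := by
  refine ⟨?_, fun h => ⟨x, h, rfl⟩⟩
  rintro ⟨y, hy, hyx⟩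
  obtain rfl : y = x := Subtype.ext hyx
  exact hy

theorem compositeValuation_le (V : ValuationSubring L)
    (W : ValuationSubring (IsLocalRing.ResidueField V)) : compositeValuation V W ≤ V := by
  rintro _ ⟨y, -, rfl⟩
  exact y.2

theorem mem_nonunits_compositeValuation {V : ValuationSubring L}
    {W : ValuationSubring (IsLocalRing.ResidueField V)} {x : V} :
    (x : L) ∈ (compositeValuation V W).nonunits ↔ IsLocalRing.residue V x ∈ W.nonunits := by
  by_cases hu : IsUnit x
  · obtain ⟨y, hy⟩ := hu.exists_right_inv
    have hxy : (x : L) * y = 1 := congrArg Subtype.val hy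
    have hres : IsLocalRing.residue V x * IsLocalRing.residue V y = 1 := by
      rw [← map_mul, hy, map_one]
    rw [ValuationSubring.mem_nonunits_iff_or, ValuationSubring.mem_nonunits_iff_or,
      inv_eq_of_mul_eq_one_right hxy, inv_eq_of_mul_eq_one_right hres, mem_compositeValuation,
      or_iff_right (left_ne_zero_of_mul_eq_one hxy), or_iff_right (left_ne_zero_of_mul_eq_one hres)]
  · have h0 : IsLocalRing.residue V x = 0 := (IsLocalRing.residue_eq_zero_iff _).2 hu
    have hx : (x : L) ∈ V.nonunits := ValuationSubring.coe_mem_nonunits_iff.2 hu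
    rw [h0]
    exact iff_of_true (ValuationSubring.nonunits_le_nonunits.2 (compositeValuation_le V W) hx)
      W.nonunits.zero_mem

/-- The center of `V` is contained in `p`, so `p` can be realised as a center in the residue field
of `V`; composing with `V` gives a smaller valuation ring of `L`. -/
theorem exists_valuationSubring_le (f : A →+* L) (V : ValuationSubring L) (hV : ∀ a, f a ∈ V)
    (p : Ideal A) [p.IsPrime] (hp : ∀ a, f a ∈ V.nonunits → a ∈ p) :
    ∃ W ≤ V, (∀ a, f a ∈ W) ∧ ∀ a, a ∈ p ↔ f a ∈ W.nonunits := by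
  let g : A →+* V := f.codRestrict V.toSubring hV
  obtain ⟨W, hW, hWp⟩ := exists_valuationSubring_of_ker_le ((IsLocalRing.residue V).comp g) p <| by
    intro a ha
    have h : g a ∈ IsLocalRing.maximalIdeal V := (IsLocalRing.residue_eq_zero_iff _).1 ha
    exact hp a (ValuationSubring.coe_mem_nonunits_iff.2 h)
  refine ⟨compositeValuation V W, compositeValuation_le V W, fun a => ?_, fun a => ?_⟩
  · exact mem_compositeValuation (x := g a).2 (hW a)
  · exact (hWp a).trans (mem_nonunits_compositeValuation (x := g a)).symm

/-- An increasing chain of prime ideals consists of the centers of a decreasing chain of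
valuation rings. -/
theorem exists_valuationSubring_chain (f : A →+* L) (p : ℕ → PrimeSpectrum A) (hp : Monotone p)
    (h0 : RingHom.ker f ≤ (p 0).asIdeal) :
    ∃ W : ℕ → ValuationSubring L, (∀ i, W (i + 1) ≤ W i) ∧
      ∀ i, (∀ a, f a ∈ W i) ∧ ∀ a, a ∈ (p i).asIdeal ↔ f a ∈ (W i).nonunits := by
  let Good : ℕ → ValuationSubring L → Prop := fun i W =>
    (∀ a, f a ∈ W) ∧ ∀ a, a ∈ (p i).asIdeal ↔ f a ∈ W.nonunits
  obtain ⟨W₀, hW₀⟩ : ∃ W, Good 0 W := exists_valuationSubring_of_ker_le f (p 0).asIdeal h0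
  have step : ∀ i (V : {V // Good i V}), ∃ W : {W // Good (i + 1) W}, W.1 ≤ V.1 := by
    rintro i ⟨V, hV1, hV2⟩
    obtain ⟨W, hWV, hW⟩ := exists_valuationSubring_le f V hV1 (p (i + 1)).asIdeal
      fun a ha => hp (Nat.le_succ i) ((hV2 a).2 ha)
    exact ⟨⟨W, hW⟩, hWV⟩
  choose next hnext using step
  let W : ∀ i, {V // Good i V} := fun i => Nat.rec ⟨W₀, hW₀⟩ next i
  exact ⟨fun i => (W i).1, fun i => hnext i (W i), fun i => (W i).2⟩

end Domination

/-! ### Both dimensions in terms of chains of valuation rings. -/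

section Chains

attribute [local instance] Ideal.Quotient.field

variable {R : Type u} {K : Type v} [CommRing R] [CommRing K] [Algebra R K]

/-- If `Z ≠ Z'`, some idempotent `f` lies in `Z` with `1 - f ∈ Z'`. For a unit `x` outside `W'`, the
unit `1 - f + f x` is `1` modulo `Z` and `x` modulo `Z'`, so it lies in `W` but not in `W'`. If `W'`
contained all units, nothing could be said about `Z'`. -/
theorem eq_of_forall_unit_mem (hK : IsUnitRegular K) {Z Z' : Ideal K} [hZ : Z.IsMaximal]
    [hZ' : Z'.IsMaximal] (W : ValuationSubring (K ⧸ Z)) (W' : ValuationSubring (K ⧸ Z'))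
    (h : ∀ x : Kˣ, Ideal.Quotient.mk Z (x : K) ∈ W → Ideal.Quotient.mk Z' (x : K) ∈ W')
    (hne : ∃ x : Kˣ, Ideal.Quotient.mk Z' (x : K) ∉ W') : Z = Z' := by
  refine hZ.eq_of_le hZ'.ne_top fun a ha => ?_
  obtain ⟨x, hx⟩ := hne
  obtain ⟨u, f, hf, rfl⟩ := hK a
  have hfZ : f ∈ Z := by
    have := Z.mul_mem_left (↑u⁻¹ : K) ha
    rwa [Units.inv_mul_cancel_left] at this
  have hff : f * f = f := hf
  by_contra hna
  have hfZ' : 1 - f ∈ Z' := by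
    refine (hZ'.isPrime.mem_or_mem (x := f) ?_).resolve_left fun h => hna (Z'.mul_mem_left _ h)
    rw [mul_sub, mul_one, hff, sub_self]
    exact Z'.zero_mem
  let y : Kˣ := ⟨1 - f + f * x, 1 - f + f * (↑x⁻¹ : K), by
    have := x.mul_inv
    linear_combination f * this + (2 - (x : K) - (↑x⁻¹ : K) + (x : K) * (↑x⁻¹ : K) - 1) * hff, by
    have := x.mul_inv
    linear_combination f * this + (2 - (x : K) - (↑x⁻¹ : K) + (x : K) * (↑x⁻¹ : K) - 1) * hff⟩
  have h1 : Ideal.Quotient.mk Z (y : K) = 1 := by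
    rw [← map_one (Ideal.Quotient.mk Z), Ideal.Quotient.eq]
    have : (y : K) - 1 = (x - 1) * f := by simp only [y]; ring
    rw [this]
    exact Z.mul_mem_left _ hfZ
  have h2 : Ideal.Quotient.mk Z' (y : K) = Ideal.Quotient.mk Z' (x : K) := by
    rw [Ideal.Quotient.eq]
    have : (y : K) - x = (1 - x) * (1 - f) := by simp only [y]; ring
    rw [this]
    exact Z'.mul_mem_left _ hfZ'
  refine hx (h2 ▸ h y ?_)
  rw [h1]
  exact W.one_mem

/-- A strictly decreasing chain `W₀ > ⋯ > Wₙ₊₁` of valuation rings which contain the image of `R`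
in one of the residue fields of `K`. -/
def HasValuationChain (R : Type u) (K : Type v) [CommRing R] [CommRing K] [Algebra R K]
    (n : ℕ) : Prop :=
  ∃ (Z : Ideal K) (_ : Z.IsMaximal) (W : ℕ → ValuationSubring (K ⧸ Z)),
    (∀ i r, Ideal.Quotient.mk Z (algebraMap R K r) ∈ W i) ∧ ∀ i ≤ n, W (i + 1) < W i

theorem exists_unit_mk_eq (hK : IsUnitRegular K) {Z : Ideal K} [hZ : Z.IsMaximal] {a : K ⧸ Z}
    (ha : a ≠ 0) : ∃ x : Kˣ, Ideal.Quotient.mk Z (x : K) = a := by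
  obtain ⟨b, rfl⟩ := Ideal.Quotient.mk_surjective a
  obtain ⟨x, hx⟩ := hK.exists_unit hZ.isPrime fun h => ha (Ideal.Quotient.eq_zero_iff_mem.2 h)
  exact ⟨x, Ideal.Quotient.eq.2 hx⟩

theorem exists_unit_of_lt (hK : IsUnitRegular K) {Z : Ideal K} [hZ : Z.IsMaximal]
    {V W : ValuationSubring (K ⧸ Z)} (h : V < W) :
    ∃ x : Kˣ, Ideal.Quotient.mk Z (x : K) ∉ V ∧ Ideal.Quotient.mk Z (x : K) ∈ W := by
  obtain ⟨a, haW, haV⟩ := SetLike.exists_of_lt h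
  obtain ⟨x, rfl⟩ := exists_unit_mk_eq hK fun h0 : a = 0 => haV (h0 ▸ V.zero_mem)
  exact ⟨x, haV, haW⟩

theorem le_of_forall_unit (hK : IsUnitRegular K) {Z : Ideal K} [hZ : Z.IsMaximal]
    {V W : ValuationSubring (K ⧸ Z)}
    (h : ∀ x : Kˣ, Ideal.Quotient.mk Z (x : K) ∈ V → Ideal.Quotient.mk Z (x : K) ∈ W) : V ≤ W := by
  intro a ha
  by_cases h0 : a = 0
  · exact h0 ▸ W.zero_mem
  · obtain ⟨x, rfl⟩ := exists_unit_mk_eq hK h0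
    exact h x ha

theorem kdimLE_valLattice_iff (hK : IsUnitRegular K) (n : ℕ) :
    KdimLE (ValLattice R K) (n : WithBot ℕ) ↔ ¬ HasValuationChain R K n := by
  rw [genLattice_kdimLE_iff, not_iff_not]
  constructor
  · rintro ⟨P, x, hP, h⟩
    have hanti : ∀ i ≤ n + 1, ∀ u, P (n + 1) u → P i u := by
      refine fun i hi => Nat.decreasingInduction (fun k hk ih u hu => ?_) (fun u hu => hu) hi
      exact (h k (by omega)).1 u (ih u hu)
    -- The residue field is taken from the smallest point of the chain, which can be compared with
    -- all the others.
    obtain ⟨Z, hZ, W, hRW, hPW⟩ := exists_valuationSubring_of_isPoint hK (hP (n + 1))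
    have key : ∀ i, ∃ V : ValuationSubring (K ⧸ Z),
        (∀ r : R, Ideal.Quotient.mk Z (algebraMap R K r) ∈ V) ∧
          (i ≤ n + 1 → ∀ u : Kˣ, P i u ↔ Ideal.Quotient.mk Z (u : K) ∈ V) := by
      intro i
      by_cases hi : i ≤ n + 1
      -- A point containing all units does not determine its residue field, so the trivial valuation
      -- ring `⊤` over the chosen `Z` represents it.
      · by_cases hfull : ∀ u, P i u
        · exact ⟨⊤, fun r => ValuationSubring.mem_top _, fun _ u =>
            iff_of_true (hfull u) (ValuationSubring.mem_top _)⟩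
        · obtain ⟨u, hu⟩ := not_forall.1 hfull
          obtain ⟨Z', hZ', V, hRV, hPV⟩ := exists_valuationSubring_of_isPoint hK (hP i)
          obtain rfl : Z = Z' := eq_of_forall_unit_mem hK W V
            (fun x hx => (hPV x).1 (hanti i hi x ((hPW x).2 hx))) ⟨u, fun h => hu ((hPV u).2 h)⟩
          exact ⟨V, hRV, fun _ => hPV⟩
      · exact ⟨⊤, fun r => ValuationSubring.mem_top _, fun h => absurd h hi⟩
    choose V hRV hPV using key
    refine ⟨Z, hZ, V, hRV, fun i hi => lt_of_le_not_ge ?_ fun hle => ?_⟩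
    · refine le_of_forall_unit hK fun u hu => ?_
      rw [← hPV _ (by omega)] at hu ⊢
      exact (h i hi).1 u hu
    · have h1 := (hPV i (by omega) (x i)).1 (h i hi).2.2
      exact (h i hi).2.1 ((hPV (i + 1) (by omega) (x i)).2 (hle h1))
  · rintro ⟨Z, hZ, W, hRW, hW⟩
    have hx : ∀ i, ∃ x : Kˣ, i ≤ n →
        Ideal.Quotient.mk Z (x : K) ∉ W (i + 1) ∧ Ideal.Quotient.mk Z (x : K) ∈ W i := by
      intro i
      by_cases hi : i ≤ n
      · obtain ⟨x, hx⟩ := exists_unit_of_lt hK (hW i hi)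
        exact ⟨x, fun _ => hx⟩
      · exact ⟨1, fun h => absurd h hi⟩
    choose x hx using hx
    exact ⟨fun i u => Ideal.Quotient.mk Z (u : K) ∈ W i, x,
      fun i => isPoint_of_valuationSubring _ _ (hRW i),
      fun i hi => ⟨fun u hu => (hW i hi).le hu, hx i hi⟩⟩

/-- With `xᵢ` in `Wᵢ` but not in `Wᵢ₊₁`, all inverses `xᵢ⁻¹` lie in the smallest ring `Wₙ₊₁`, so
every `Wᵢ` has a center on the algebra they generate. The element `xᵢ⁻¹` is a unit in `Wᵢ` and a
nonunit in `Wᵢ₊₁`, which makes the centers strictly increase. -/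
theorem exists_lt_ringKrullDim (hK : IsUnitRegular K) {n : ℕ} (h : HasValuationChain R K n) :
    ∃ (m : ℕ) (x : Fin m → K),
      ((n + 1 : ℕ) : WithBot ℕ∞) ≤ ringKrullDim (Algebra.adjoin R (Set.range x)) := by
  obtain ⟨Z, hZ, W, hRW, hW⟩ := h
  have hlast : ∀ i ≤ n + 1, W (n + 1) ≤ W i := by
    refine fun i hi => Nat.decreasingInduction (fun k hk ih => ?_) le_rfl hi
    exact ih.trans (hW k (by omega)).le
  have hx : ∀ i : Fin (n + 1), ∃ x : Kˣ,
      Ideal.Quotient.mk Z (x : K) ∉ W (i + 1) ∧ Ideal.Quotient.mk Z (x : K) ∈ W i := fun i =>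
    exists_unit_of_lt hK (hW i (by omega))
  choose x hx1 hx2 using hx
  have hinv : ∀ i, Ideal.Quotient.mk Z (↑(x i)⁻¹ : K) = (Ideal.Quotient.mk Z (x i : K))⁻¹ := by
    intro i
    refine eq_inv_of_mul_eq_one_left ?_
    rw [← map_mul, Units.inv_mul, map_one]
  refine ⟨n + 1, fun i => (↑(x i)⁻¹ : K), ?_⟩
  set A := Algebra.adjoin R (Set.range fun i => (↑(x i)⁻¹ : K))
  have hA : ∀ a ∈ A, Ideal.Quotient.mk Z a ∈ W (n + 1) := by
    intro a ha
    induction ha using Algebra.adjoin_induction with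
    | mem a ha =>
      obtain ⟨i, rfl⟩ := ha
      rw [hinv]
      exact ((W (n + 1)).mem_or_inv_mem _).resolve_left fun h => hx1 i (hlast _ (by omega) h)
    | algebraMap r => exact hRW _ r
    | add a b _ _ ha hb =>
      rw [map_add]
      exact add_mem ha hb
    | mul a b _ _ ha hb =>
      rw [map_mul]
      exact mul_mem ha hb
  let f : A →+* K ⧸ Z := (Ideal.Quotient.mk Z).comp A.toSubring.subtype
  have hf : ∀ i : Fin (n + 2), ∀ a, f a ∈ (W i).toSubring := fun i a =>
    hlast i (by omega) (hA a a.2)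
  let p : Fin (n + 2) → PrimeSpectrum A := fun i =>
    PrimeSpectrum.comap (f.codRestrict (W i).toSubring (hf i))
      (IsLocalRing.closedPoint (W i))
  have hp : ∀ i a, a ∈ (p i).asIdeal ↔ f a ∈ (W i).nonunits := fun i a =>
    ValuationSubring.coe_mem_nonunits_iff (A := W i) (a := f.codRestrict (W i).toSubring (hf i) a)
      |>.symm
  have hlt : ∀ i : Fin (n + 1), p i.castSucc < p i.succ := by
    intro i
    refine lt_of_le_not_ge (fun a ha => ?_) fun hle => ?_
    · refine (hp _ a).2 (ValuationSubring.nonunits_le_nonunits.2 ?_ ((hp _ a).1 ha))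
      exact (hW i (by omega)).le
    · let y : A := ⟨(↑(x i)⁻¹ : K), Algebra.subset_adjoin ⟨i, rfl⟩⟩
      have hy : f y = (Ideal.Quotient.mk Z (x i : K))⁻¹ := hinv i
      have h1 : y ∈ (p i.succ).asIdeal := by
        rw [hp, hy, ValuationSubring.inv_mem_nonunits_iff]
        exact .inr (hx1 i)
      have h2 := (hp _ y).1 (hle h1)
      rw [hy, ValuationSubring.inv_mem_nonunits_iff] at h2
      refine h2.elim (fun h0 => hx1 i ?_) fun h => h (hx2 i)
      rw [h0]
      exact (W _).zero_mem
  exact Order.LTSeries.length_le_krullDim (⟨n + 1, p, hlt⟩ : LTSeries (PrimeSpectrum A))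

theorem hasValuationChain_of_le_ringKrullDim (hK : IsUnitRegular K) {n : ℕ} (A : Subalgebra R K)
    (h : ((n + 1 : ℕ) : WithBot ℕ∞) ≤ ringKrullDim A) : HasValuationChain R K n := by
  obtain ⟨l, hl⟩ := Order.le_krullDim_iff.1 h
  -- The chain of primes is continued as a constant beyond index `n + 1`.
  let p : ℕ → PrimeSpectrum A := fun i => l (Fin.ofNat _ (min i (n + 1)))
  have hpval : ∀ i, (Fin.ofNat (l.length + 1) (min i (n + 1)) : ℕ) = min i (n + 1) := fun i =>
    Nat.mod_eq_of_lt (by omega)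
  have hmono : Monotone p := fun i j hij => l.monotone <| by
    rw [Fin.le_def, hpval, hpval]
    omega
  have hlt : ∀ i ≤ n, p i < p (i + 1) := fun i hi => l.strictMono <| by
    rw [Fin.lt_def, hpval, hpval]
    omega
  obtain ⟨q, hq, hqp⟩ := Ideal.exists_minimalPrimes_le (bot_le : ⊥ ≤ (p 0).asIdeal)
  -- Minimal primes are contracted along the injection of `A` into `K`; a general prime of `A` need
  -- not be.
  obtain ⟨Z, hZ, hZq⟩ := Ideal.exists_comap_eq_of_mem_minimalPrimes_of_injective
    (f := A.toSubring.subtype) Subtype.val_injective q hq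
  have hZmax := hK.isMaximal_of_isPrime hZ
  let f : A →+* K ⧸ Z := (Ideal.Quotient.mk Z).comp A.toSubring.subtype
  obtain ⟨W, hW, hWp⟩ := exists_valuationSubring_chain f p hmono <| by
    refine le_trans (fun a ha => ?_) hqp
    rw [← hZq]
    exact (Ideal.Quotient.eq_zero_iff_mem (I := Z) (a := (a : K))).1 ha
  refine ⟨Z, hZmax, W, fun i r => (hWp i).1 (algebraMap R A r), fun i hi => ?_⟩
  refine lt_of_le_of_ne (hW i) fun heq => (hlt i hi).not_ge fun a ha => ?_
  rw [(hWp _).2] at ha ⊢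
  rwa [← heq]

theorem forall_ringKrullDim_le_iff (hK : IsUnitRegular K) (n : ℕ) :
    (∀ (m : ℕ) (x : Fin m → K),
      ringKrullDim (Algebra.adjoin R (Set.range x)) ≤ ((n : ℕ∞) : WithBot ℕ∞)) ↔
        ¬ HasValuationChain R K n := by
  have hlt : ∀ d : WithBot ℕ∞, d ≤ ((n : ℕ∞) : WithBot ℕ∞) ↔
      ¬ ((n + 1 : ℕ) : WithBot ℕ∞) ≤ d := by
    intro d
    rw [not_le]
    induction d with
    | bot => simp
    | coe d =>
      norm_cast
      exact (ENat.lt_add_one_iff (ENat.natCast_ne_top n)).symm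
  constructor
  · intro h hch
    obtain ⟨m, x, hx⟩ := exists_lt_ringKrullDim hK hch
    exact (hlt _).1 (h m x) hx
  · intro h m x
    rw [hlt]
    exact fun hle => h (hasValuationChain_of_le_ringKrullDim hK _ hle)

theorem subsingleton_valLattice_iff (hK : IsUnitRegular K) :
    Subsingleton (ValLattice R K) ↔ Subsingleton K := by
  rw [genLattice_subsingleton_iff, ← not_nontrivial_iff_subsingleton, not_iff_not]
  constructor
  · rintro ⟨P, hP⟩
    obtain ⟨Z, hZ, -⟩ := exists_valuationSubring_of_isPoint hK hP
    have : Nontrivial (K ⧸ Z) := Ideal.Quotient.nontrivial_iff.2 hZ.ne_top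
    exact (Ideal.Quotient.mk Z).domain_nontrivial
  · intro _
    obtain ⟨Z, hZ⟩ := Ideal.exists_maximal K
    exact ⟨_, isPoint_of_valuationSubring (Ideal.Quotient.mk Z) ⊤ fun r =>
      ValuationSubring.mem_top _⟩

end Chains

/-! ### The total ring of fractions of a pp-ring. -/

section FractionRing

/-- If the idempotent `e` generates the annihilator of `r`, then `r + e` is a non-zero-divisor and
`r = (r + e)(1 - e)`; in the ring of fractions `r + e` becomes a unit. -/
theorem IsPPRing.isUnitRegular_fractionRing {R : Type u} [CommRing R] (hR : IsPPRing R) :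
    IsUnitRegular (FractionRing R) := by
  intro a
  obtain ⟨r, s, rfl⟩ := IsLocalization.exists_mk'_eq (nonZeroDivisors R) a
  obtain ⟨e, he, hann⟩ := hR r
  have hmem : ∀ c : R, c * r = 0 ↔ c ∈ Ideal.span {e} := by
    intro c
    rw [← hann, Ideal.span, Submodule.mem_annihilator_span_singleton, smul_eq_mul]
  have her : e * r = 0 := (hmem e).2 (Ideal.mem_span_singleton_self e)
  have hee : e * e = e := he
  have hreg : r + e ∈ nonZeroDivisors R := by
    refine mem_nonZeroDivisors_iff_right.2 fun c hc => ?_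
    have hce : c * e = 0 := by linear_combination e * hc - c * her - c * hee
    have hcr : c * r = 0 := by linear_combination hc - hce
    obtain ⟨d, rfl⟩ := Ideal.mem_span_singleton'.1 ((hmem c).1 hcr)
    linear_combination hce - d * hee
  obtain ⟨u, hu⟩ := IsLocalization.map_units (FractionRing R) (⟨r + e, hreg⟩ : nonZeroDivisors R)
  obtain ⟨v, hv⟩ := IsLocalization.map_units (FractionRing R) s
  refine ⟨u * v⁻¹, algebraMap R _ (1 - e), he.one_sub.map _, ?_⟩
  rw [IsLocalization.mk'_eq_iff_eq_mul, Units.val_mul, hu, ← hv]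
  have : (algebraMap R (FractionRing R)) r = algebraMap R _ (r + e) * algebraMap R _ (1 - e) := by
    rw [← map_mul]
    congr 1
    linear_combination her + hee
  rw [this]
  linear_combination (-algebraMap R (FractionRing R) (r + e) * algebraMap R _ (1 - e)) * v.inv_mul

end FractionRing

end ValuativeDim

theorem lemma3p5 {R : Type*} [CommRing R] (hR : ValuativeDim.IsPPRing R) :
    (IsReduced (FractionRing R) ∧ Ring.KrullDimLE 0 (FractionRing R)) ∧
      ∀ n : WithBot ℕ, ValuativeDim.vdimLE R n ↔ ValuativeDim.VdimLE R n := by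
  have hK := hR.isUnitRegular_fractionRing
  refine ⟨⟨hK.isReduced, hK.krullDimLE_zero⟩, fun n => ?_⟩
  match n with
  | ⊥ =>
    -- For `n = -1` both conditions say that the ring of fractions is trivial; `R` embeds in it.
    have hinj := IsFractionRing.injective R (FractionRing R)
    refine Iff.trans ⟨fun h => ?_, fun h => ?_⟩
      (ValuativeDim.subsingleton_valLattice_iff (R := R) hK).symm
    · have : Subsingleton R := h
      exact Module.subsingleton R (FractionRing R)
    · have : Subsingleton (FractionRing R) := h
      exact hinj.subsingleton
  | (n : ℕ) =>
    exact (ValuativeDim.forall_ringKrullDim_le_iff hK n).trans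
      (ValuativeDim.kdimLE_valLattice_iff hK n).symm
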